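/- **Lemma 5.10.** Let $0<\mu<4$, $a,b>0$, $I_\mu(x)=|x|^{-\mu}$ on $\mathbb R^4$, and let $F:\mathbb R\times\mathbb R\to\mathbb R$; write $z=(z_1,z_2)$, $|z|=(z_1^2+z_2^2)^{1/2}$, $\nabla F=(F_{z_1},F_{z_2})$. Assume: - $(F_1)$ $F_{z_1},F_{z_2}$ exist and are continuous on $\mathbb R\times\mathbb R$, and for some $\tau>2-\frac\mu4$, $F_{z_j}(z)=o(|z|^\tau)$ as $|z|\to0$, $j=1,2$; - $(F_2)$ there is $\theta>3-\frac\mu4$ with $0<\theta F(z)\le z\cdot\nabla F(z)$ for all $z\ne(0,0)$; - $(F_6)$ there is $\varrho>0$ with $\displaystyle\liminf_{|z_1|,|z_2|\to+\infty}\frac{F(z)\,[z\cdot\nabla F(z)]}{e^{64\pi^2|z|^2}}\ge\varrho$; - (exponential critical growth) for $j=1,2$: $\displaystyle\lim_{|z|\to+\infty}\frac{|F_{z_j}(z)|}{e^{\alpha|z|^2}}=0$ for all $\alpha>32\pi^2$, and $\displaystyle\lim_{|z_1|,|z_2|\to+\infty}\frac{|F_{z_j}(z)|}{e^{\alpha|z|^2}}=+\infty$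 for all $0<\alpha<32\pi^2$. For $u,v\in H^2(\mathbb R^4)$ (real valued) put $$\mathcal J(u,v)=\frac12\int_{\mathbb R^4}(|\Delta u|^2+|\Delta v|^2)\,dx-\frac12\int_{\mathbb R^4}(I_\mu*F(u,v))F(u,v)\,dx,$$ $$P(u,v)=\int_{\mathbb R^4}(|\Delta u|^2+|\Delta v|^2)\,dx-\int_{\mathbb R^4}(I_\mu*F(u,v))\,\mathfrak F(u,v)\,dx,\qquad \mathfrak F(z)=z\cdot\nabla F(z)-\Big(2-\frac\mu4\Big)F(z),$$ and let $$\mathcal P(a,b)=\Big\{(u,v)\in H^2(\mathbb R^4)^2:\ \|u\|_2=a,\ \|v\|_2=b,\ P(u,v)=0\Big\},\qquad E(a,b)=\inf_{(u,v)\in\mathcal P(a,b)}\mathcal J(u,v).$$ Let $\varphi\in C_0^\infty([0,\infty),[0,1])$ with $\varphi=1$ on $[0,1]$ and $\varphi=0$ on $[2,\infty)$, and for integers $n\ge2$ let $$\tilde\omega_n(x)=\begin{cases}\sqrt{\dfrac{\log n}{8\pi^2}}+\dfrac{1-n^2|x|^2}{\sqrt{32\pi^2\log n}},&|x|\le\frac1n,\\[2mm]-\dfrac{\log|x|}{\sqrt{8\pi^2\log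 n}},&\frac1n<|x|\le1,\\[2mm]-\dfrac{\varphi(|x|)\log|x|}{\sqrt{8\pi^2\log n}},&1<|x|<2,\\[2mm]0,&|x|\ge2,\end{cases}\qquad \omega_n^c=\frac{c\,\tilde\omega_n}{\|\tilde\omega_n\|_2}\quad(c>0),$$ $$g_n(t)=\mathcal J\big(t\,\omega_n^a(t^{1/2}\,\cdot),\,t\,\omega_n^b(t^{1/2}\,\cdot)\big),\qquad t>0.$$ Then for all sufficiently large $n$ the maximum $\max_{t>0}g_n(t)$ is attained, and $$E(a,b)\le\max_{t>0}g_n(t)<\frac{8-\mu}{16}.$$ -/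

import Mathlib

open MeasureTheory Set Filter Topology Asymptotics
open scoped ContDiff

noncomputable section

namespace BiharmonicChoquard

/-- Four dimensional Euclidean space. -/
abbrev R4 := EuclideanSpace ℝ (Fin 4)

/-! ### The Sobolev space `H²(ℝ⁴)` of real valued functions and the weak Laplacian -/

/-- `g` is the weak partial derivative `∂ᵢ u`: `∫ u ∂ᵢφ = - ∫ g φ` for all test functions `φ`. -/
def IsWeakPartial (i : Fin 4) (u g : R4 → ℝ) : Prop :=
  ∀ φ : R4 → ℝ, ContDiff ℝ ∞ φ → HasCompactSupport φ →
    ∫ x, u x * fderiv ℝ φ x (EuclideanSpace.single i 1) = -∫ x, g x * φ x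

/-- `u ∈ H²(ℝ⁴)`: `u` and its weak partial derivatives of order one and two are in `L²(ℝ⁴)`. -/
def MemH2 (u : R4 → ℝ) : Prop :=
  MemLp u 2 volume ∧
    ∃ (g : Fin 4 → R4 → ℝ) (h : Fin 4 → Fin 4 → R4 → ℝ),
      (∀ i, MemLp (g i) 2 volume ∧ IsWeakPartial i u (g i)) ∧
      (∀ i j, MemLp (h i j) 2 volume ∧ IsWeakPartial j (g i) (h i j))

/-- `f` is the weak Laplacian of `u`: `∫ u Δφ = ∫ f φ` for all test functions `φ`. -/
def IsWeakLaplacian (u f : R4 → ℝ) : Prop :=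
  ∀ φ : R4 → ℝ, ContDiff ℝ ∞ φ → HasCompactSupport φ →
    ∫ x, u x * Laplacian.laplacian φ x = ∫ x, f x * φ x

open Classical in
/-- The weak Laplacian of `u` (unique up to null sets; it exists for every `u ∈ H²(ℝ⁴)`). -/
def weakLaplacian (u : R4 → ℝ) : R4 → ℝ :=
  if h : ∃ f : R4 → ℝ, LocallyIntegrable f volume ∧ IsWeakLaplacian u f then h.choose else 0

/-! ### The nonlinearity -/

/-- The Euclidean norm `|z|` on `ℝ × ℝ`. -/
def euclNorm (z : ℝ × ℝ) : ℝ := Real.sqrt (z.1 ^ 2 + z.2 ^ 2)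

/-- The partial derivative `F_{z₁}`. -/
def dF1 (F : ℝ × ℝ → ℝ) (z : ℝ × ℝ) : ℝ := deriv (fun s => F (s, z.2)) z.1

/-- The partial derivative `F_{z₂}`. -/
def dF2 (F : ℝ × ℝ → ℝ) (z : ℝ × ℝ) : ℝ := deriv (fun s => F (z.1, s)) z.2

/-- `z · ∇F(z)`. -/
def zGradF (F : ℝ × ℝ → ℝ) (z : ℝ × ℝ) : ℝ := z.1 * dF1 F z + z.2 * dF2 F z

/-- `𝔉(z) = z · ∇F(z) - (2 - μ/4) F(z)`. -/
def frakF (μ : ℝ) (F : ℝ × ℝ → ℝ) (z : ℝ × ℝ) : ℝ := zGradF F z - (2 - μ / 4) * F z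

/-- The filter `|z| → ∞` on `ℝ × ℝ`. -/
def normAtTop : Filter (ℝ × ℝ) := comap euclNorm atTop

/-- The filter `|z₁|, |z₂| → ∞` (both coordinates) on `ℝ × ℝ`. -/
def bothAtTop : Filter (ℝ × ℝ) :=
  comap (fun z : ℝ × ℝ => |z.1|) atTop ⊓ comap (fun z : ℝ × ℝ => |z.2|) atTop

/-- `(F₁)`: the partial derivatives of `F` exist and are continuous (i.e. `F` is `C¹`), and
`F_{z_j}(z) = o(|z|^τ)` as `|z| → 0` for some `τ > 2 - μ/4`. -/
def CondF1 (μ : ℝ) (F : ℝ × ℝ → ℝ) : Prop :=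
  ContDiff ℝ 1 F ∧ ∃ τ : ℝ, 2 - μ / 4 < τ ∧
    dF1 F =o[𝓝[≠] 0] (fun z => euclNorm z ^ τ) ∧
    dF2 F =o[𝓝[≠] 0] (fun z => euclNorm z ^ τ)

/-- `(F₂)`: there is `θ > 3 - μ/4` with `0 < θ F(z) ≤ z · ∇F(z)` for all `z ≠ 0`. -/
def CondF2 (μ : ℝ) (F : ℝ × ℝ → ℝ) : Prop :=
  ∃ θ : ℝ, 3 - μ / 4 < θ ∧ ∀ z : ℝ × ℝ, z ≠ 0 → 0 < θ * F z ∧ θ * F z ≤ zGradF F z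

/-- `(F₆)`: there is `ϱ > 0` with
`liminf F(z) [z · ∇F(z)] / exp(64 π² |z|²) ≥ ϱ` as `|z₁|, |z₂| → ∞`. -/
def CondF6 (F : ℝ × ℝ → ℝ) : Prop :=
  ∃ ϱ : ℝ, 0 < ϱ ∧
    (ϱ : EReal) ≤ liminf (fun z : ℝ × ℝ =>
      ((F z * zGradF F z / Real.exp (64 * Real.pi ^ 2 * euclNorm z ^ 2) : ℝ) : EReal)) bothAtTop

/-- Exponential critical growth at infinity of a partial derivative `f` of `F`, with critical
exponent `32 π²`. The upper half is a limit as `|z| → ∞`. The lower half is a limit as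
`|z₁|, |z₂| → ∞`: a continuous `f = F_{z_j}` with `|f(z)| → ∞` as `|z| → ∞` has a constant sign
near infinity, which is impossible when `z · ∇F(z) > 0` for all `z ≠ 0`. -/
def CriticalGrowth (f : ℝ × ℝ → ℝ) : Prop :=
  (∀ α : ℝ, 32 * Real.pi ^ 2 < α →
    Tendsto (fun z => |f z| / Real.exp (α * euclNorm z ^ 2)) normAtTop (𝓝 0)) ∧
  (∀ α : ℝ, 0 < α → α < 32 * Real.pi ^ 2 →
    Tendsto (fun z => |f z| / Real.exp (α * euclNorm z ^ 2)) bothAtTop atTop)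

/-! ### The variational setting -/

/-- The convolution `I_μ * h`, where `I_μ(x) = |x|^{-μ}`. -/
def rieszConv (μ : ℝ) (h : R4 → ℝ) (x : R4) : ℝ := ∫ y, ‖x - y‖ ^ (-μ) * h y

/-- `∫ (|Δu|² + |Δv|²) dx`. -/
def laplaceEnergy (u v : R4 → ℝ) : ℝ :=
  ∫ x, (weakLaplacian u x ^ 2 + weakLaplacian v x ^ 2)

/-- The energy functional
`𝒥(u,v) = ½ ∫ (|Δu|² + |Δv|²) - ½ ∫ (I_μ * F(u,v)) F(u,v)`. -/
def energyJ (μ : ℝ) (F : ℝ × ℝ → ℝ) (u v : R4 → ℝ) : ℝ :=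
  1 / 2 * laplaceEnergy u v
    - 1 / 2 * ∫ x, rieszConv μ (fun y => F (u y, v y)) x * F (u x, v x)

/-- The Pohozaev functional `P(u,v) = ∫ (|Δu|² + |Δv|²) - ∫ (I_μ * F(u,v)) 𝔉(u,v)`. -/
def pohozaevP (μ : ℝ) (F : ℝ × ℝ → ℝ) (u v : R4 → ℝ) : ℝ :=
  laplaceEnergy u v - ∫ x, rieszConv μ (fun y => F (u y, v y)) x * frakF μ F (u x, v x)

/-- The constraint `𝒮`: pairs in `H² × H²` with `∫ |u|² = a²` and `∫ |v|² = b²`. -/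
def massS (a b : ℝ) : Set ((R4 → ℝ) × (R4 → ℝ)) :=
  {w | MemH2 w.1 ∧ MemH2 w.2 ∧ ∫ x, w.1 x ^ 2 = a ^ 2 ∧ ∫ x, w.2 x ^ 2 = b ^ 2}

/-- The Pohozaev manifold `𝒫(a,b)`. -/
def pohozaevSet (μ : ℝ) (F : ℝ × ℝ → ℝ) (a b : ℝ) : Set ((R4 → ℝ) × (R4 → ℝ)) :=
  {w | w ∈ massS a b ∧ pohozaevP μ F w.1 w.2 = 0}

/-- The ground state energy `E(a,b) = inf 𝒥` over `𝒫(a,b)`, as an extended real number. -/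
def groundEnergy (μ : ℝ) (F : ℝ × ℝ → ℝ) (a b : ℝ) : EReal :=
  ⨅ w ∈ pohozaevSet μ F a b, ((energyJ μ F w.1 w.2 : ℝ) : EReal)

/-! ### The modified Adams functions and the fibering energy -/

/-- A cut-off `φ ∈ C₀^∞([0,∞), [0,1])` with `φ = 1` on `[0,1]` and `φ = 0` on `[2,∞)`. -/
def IsCutoff (φ : ℝ → ℝ) : Prop :=
  ContDiffOn ℝ ∞ φ (Ici 0) ∧ (∀ t, 0 ≤ t → 0 ≤ φ t ∧ φ t ≤ 1) ∧
    (∀ t, 0 ≤ t → t ≤ 1 → φ t = 1) ∧ (∀ t, 2 ≤ t → φ t = 0)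

/-- The modified Adams function `ω̃_n`. -/
def adams (φ : ℝ → ℝ) (n : ℕ) (x : R4) : ℝ :=
  if ‖x‖ ≤ 1 / (n : ℝ) then
    Real.sqrt (Real.log n / (8 * Real.pi ^ 2))
      + (1 - (n : ℝ) ^ 2 * ‖x‖ ^ 2) / Real.sqrt (32 * Real.pi ^ 2 * Real.log n)
  else if ‖x‖ ≤ 1 then
    -(Real.log ‖x‖ / Real.sqrt (8 * Real.pi ^ 2 * Real.log n))
  else if ‖x‖ < 2 then
    -(φ ‖x‖ * Real.log ‖x‖ / Real.sqrt (8 * Real.pi ^ 2 * Real.log n))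
  else 0

/-- The mass normalized function `ω_n^c = c ω̃_n / ‖ω̃_n‖₂`. -/
def adamsMass (φ : ℝ → ℝ) (c : ℝ) (n : ℕ) (x : R4) : ℝ :=
  c * adams φ n x / Real.sqrt (∫ y, adams φ n y ^ 2)

/-- The fibering energy `g_n(t) = 𝒥(t ω_n^a(t^{1/2} x), t ω_n^b(t^{1/2} x))`. -/
def fiberG (μ : ℝ) (F : ℝ × ℝ → ℝ) (a b : ℝ) (φ : ℝ → ℝ) (n : ℕ) (t : ℝ) : ℝ :=
  energyJ μ F (fun x => t * adamsMass φ a n (Real.sqrt t • x))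
    (fun x => t * adamsMass φ b n (Real.sqrt t • x))

end BiharmonicChoquard

end

/-! The dilation `u ↦ t u(√t ·)` preserves the `L²` norm in dimension four, multiplies the Laplacian
energy by `t²`, and turns the Choquard term into `t^(μ/2-4)` times the Riesz form of `F(t w)`. The
derivative of the fibering energy at `t` is therefore `P / t` (`hasDerivAt_fiberEnergy`).
Superhomogeneity of degree `θ` makes the nonlocal term grow faster than `t²`, because `2θ + μ/2 - 4
> 2`, so a maximum is attained (`SuperHomogeneous.exists_max_fiberEnergy`). A maximizer satisfies `P
= 0` and has the right masses, hence it competes in the infimum `E(a,b)`.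

Let `Y` be the Laplacian energy at a maximizer. The Riesz form of `F` is nonnegative, so the maximum
is at most `Y / 2`, and it suffices to show `Y < y₀ = (8-μ)/8` for large `n`
(`eventually_subcritical`). Suppose `Y ≥ y₀` and put `l = log n`. The equation `P = 0` bounds `Y`
below by the Riesz form over the ball of radius `1/n`. There `(F₆)` gives `n^(μ-8) = exp(-8 l y₀)`
times an exponential (`exp_le_rieszForm_adams`). The unnormalized Laplacian energy is exactly `8π² l
+ C₁` (`IsLogTruncation.integral_lineDivergence_sq`), so the exponent is at least `8 l Y - C Y`. The
mass stays bounded (`IsLogTruncation.exists_adamsRawMass_le`), so `t² ≲ Y / l`, and the prefactor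
`t^(μ/2-4)` contributes `l^q Y^(-q)` with `q = 2 - μ/4 > 0`. Thus `Y ≥ c l^q Y^(-q) exp(8 l (Y - y₀)
- C Y)`. This fails for large `l`, uniformly in `Y ≥ y₀` (`eventually_lt_rpow_mul_exp`); at `Y = y₀`
the factor `l^q` alone decides.

The Adams functions are only `C^{1,1}`, so membership in `H²` and the weak Laplacian come from
integration by parts for Lipschitz functions. -/

noncomputable section

namespace BiharmonicChoquard

/-! ### Consequences of the growth hypotheses on the nonlinearity -/

lemma zGradF_eq_fderiv {F : ℝ × ℝ → ℝ} (hF : ContDiff ℝ 1 F) (z : ℝ × ℝ) :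
    zGradF F z = fderiv ℝ F z z := by
  have hd : HasFDerivAt F (fderiv ℝ F z) z :=
    ((hF.differentiable one_ne_zero) z).hasFDerivAt
  have h1 : HasDerivAt (fun s : ℝ => (s, z.2)) ((1 : ℝ), (0 : ℝ)) z.1 :=
    (hasDerivAt_id z.1).prodMk (hasDerivAt_const z.1 z.2)
  have h2 : HasDerivAt (fun s : ℝ => (z.1, s)) ((0 : ℝ), (1 : ℝ)) z.2 :=
    (hasDerivAt_const z.2 z.1).prodMk (hasDerivAt_id z.2)
  have e1 : dF1 F z = fderiv ℝ F z (1, 0) :=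
    (HasFDerivAt.comp_hasDerivAt (f := fun s : ℝ => (s, z.2)) z.1 hd h1).deriv
  have e2 : dF2 F z = fderiv ℝ F z (0, 1) :=
    (HasFDerivAt.comp_hasDerivAt (f := fun s : ℝ => (z.1, s)) z.2 hd h2).deriv
  have hz : z = z.1 • ((1 : ℝ), (0 : ℝ)) + z.2 • ((0 : ℝ), (1 : ℝ)) := by
    ext <;> simp
  rw [zGradF, e1, e2]
  conv_rhs => rw [hz, map_add, map_smul, map_smul]
  simp

lemma continuous_zGradF {F : ℝ × ℝ → ℝ} (hF : ContDiff ℝ 1 F) : Continuous (zGradF F) := by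
  have : zGradF F = fun z => fderiv ℝ F z z := funext (zGradF_eq_fderiv hF)
  rw [this]
  exact (hF.continuous_fderiv one_ne_zero).clm_apply continuous_id

lemma continuous_frakF {F : ℝ × ℝ → ℝ} (hF : ContDiff ℝ 1 F) (μ : ℝ) :
    Continuous (frakF μ F) :=
  (continuous_zGradF hF).sub (continuous_const.mul hF.continuous)

lemma zGradF_zero (F : ℝ × ℝ → ℝ) : zGradF F 0 = 0 := by simp [zGradF]

lemma hasDerivAt_ray {F : ℝ × ℝ → ℝ} (hF : ContDiff ℝ 1 F) (z : ℝ × ℝ) {s : ℝ} (hs : s ≠ 0) :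
    HasDerivAt (fun s : ℝ => F (s • z)) (s⁻¹ * zGradF F (s • z)) s := by
  have hd : HasFDerivAt F (fderiv ℝ F (s • z)) (s • z) :=
    ((hF.differentiable one_ne_zero) _).hasFDerivAt
  have h1 : HasDerivAt (fun s : ℝ => s • z) z s := by
    simpa using (hasDerivAt_id s).smul_const z
  rw [zGradF_eq_fderiv hF, map_smul, smul_eq_mul, inv_mul_cancel_left₀ hs]
  exact hd.comp_hasDerivAt s h1

/-- The Ambrosetti–Rabinowitz type condition with a given exponent. -/
def SuperHomogeneous (θ : ℝ) (F : ℝ × ℝ → ℝ) : Prop :=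
  ∀ z : ℝ × ℝ, z ≠ 0 → 0 < θ * F z ∧ θ * F z ≤ zGradF F z

/-! ### Superhomogeneity along rays. -/

section

variable {F : ℝ × ℝ → ℝ} {θ : ℝ}

lemma SuperHomogeneous.pos (h : SuperHomogeneous θ F) (hθ : 0 < θ) {z : ℝ × ℝ} (hz : z ≠ 0) :
    0 < F z := (mul_pos_iff_of_pos_left hθ).1 (h z hz).1

/-- The condition says nothing at the origin; letting `z → 0` in `0 < θ F ≤ z · ∇F` squeezes `θ F 0`
between `0` and `zGradF F 0 = 0`. -/
lemma SuperHomogeneous.zero (h : SuperHomogeneous θ F) (hθ : 0 < θ) (hF : ContDiff ℝ 1 F) :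
    F 0 = 0 := by
  have hc : Tendsto (fun z => θ * F z) (𝓝[≠] 0) (𝓝 (θ * F 0)) :=
    ((continuous_const.mul hF.continuous).tendsto 0).mono_left nhdsWithin_le_nhds
  have hg : Tendsto (zGradF F) (𝓝[≠] 0) (𝓝 0) := by
    have := ((continuous_zGradF hF).tendsto 0).mono_left (nhdsWithin_le_nhds (s := {0}ᶜ))
    rwa [zGradF_zero] at this
  have hle : θ * F 0 ≤ 0 := le_of_tendsto_of_tendsto hc hg
    (eventually_nhdsWithin_of_forall fun z hz => (h z hz).2)
  have hge : 0 ≤ θ * F 0 := ge_of_tendsto hc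
    (eventually_nhdsWithin_of_forall fun z hz => (h z hz).1.le)
  have := le_antisymm hle hge
  simpa [hθ.ne'] using this

lemma SuperHomogeneous.nonneg (h : SuperHomogeneous θ F) (hθ : 0 < θ) (hF : ContDiff ℝ 1 F)
    (z : ℝ × ℝ) : 0 ≤ F z := by
  rcases eq_or_ne z 0 with rfl | hz
  · exact (h.zero hθ hF).ge
  · exact (h.pos hθ hz).le

lemma SuperHomogeneous.mul_le_zGradF (h : SuperHomogeneous θ F) (hθ : 0 < θ)
    (hF : ContDiff ℝ 1 F) (z : ℝ × ℝ) : θ * F z ≤ zGradF F z := by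
  rcases eq_or_ne z 0 with rfl | hz
  · simp [h.zero hθ hF, zGradF_zero]
  · exact (h z hz).2

lemma SuperHomogeneous.zGradF_nonneg (h : SuperHomogeneous θ F) (hθ : 0 < θ)
    (hF : ContDiff ℝ 1 F) (z : ℝ × ℝ) : 0 ≤ zGradF F z :=
  (mul_nonneg hθ.le (h.nonneg hθ hF z)).trans (h.mul_le_zGradF hθ hF z)

/-- The derivative is `s^(-θ-1) (z · ∇F - θ F)` evaluated at `s • z`. All growth comparisons along
rays follow from this. -/
lemma SuperHomogeneous.monotoneOn (h : SuperHomogeneous θ F) (hθ : 0 < θ)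
    (hF : ContDiff ℝ 1 F) (z : ℝ × ℝ) :
    MonotoneOn (fun s : ℝ => s ^ (-θ) * F (s • z)) (Ioi 0) := by
  have hder : ∀ s ∈ Ioi (0 : ℝ), HasDerivAt (fun s : ℝ => s ^ (-θ) * F (s • z))
      (-θ * s ^ (-θ - 1) * F (s • z) + s ^ (-θ) * (s⁻¹ * zGradF F (s • z))) s := by
    intro s hs
    exact (Real.hasDerivAt_rpow_const (Or.inl (ne_of_gt hs))).mul
      (hasDerivAt_ray hF z (ne_of_gt hs))
  refine monotoneOn_of_deriv_nonneg (convex_Ioi 0)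
    (fun s hs => (hder s hs).continuousAt.continuousWithinAt) ?_ ?_
  · rw [interior_Ioi]
    exact fun s hs => (hder s hs).differentiableAt.differentiableWithinAt
  · rw [interior_Ioi]
    intro s hs
    have hs' : 0 < s := hs
    rw [(hder s hs).deriv, Real.rpow_sub_one hs'.ne']
    have h1 := h.mul_le_zGradF hθ hF (s • z)
    have h2 : 0 ≤ s ^ (-θ) / s := by positivity
    calc (0 : ℝ) ≤ (s ^ (-θ) / s) * (zGradF F (s • z) - θ * F (s • z)) :=
          mul_nonneg h2 (sub_nonneg.2 h1)
      _ = _ := by field_simp; ring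

lemma SuperHomogeneous.le_of_le_one (h : SuperHomogeneous θ F) (hθ : 0 < θ)
    (hF : ContDiff ℝ 1 F) (z : ℝ × ℝ) {s : ℝ} (hs : 0 < s) (hs1 : s ≤ 1) :
    F (s • z) ≤ s ^ θ * F z := by
  have := h.monotoneOn hθ hF z hs (mem_Ioi.2 one_pos) hs1
  simp only [Real.one_rpow, one_mul, one_smul] at this
  rwa [Real.rpow_neg hs.le, inv_mul_le_iff₀ (by positivity)] at this

lemma SuperHomogeneous.le_of_one_le (h : SuperHomogeneous θ F) (hθ : 0 < θ)
    (hF : ContDiff ℝ 1 F) (z : ℝ × ℝ) {s : ℝ} (hs1 : 1 ≤ s) :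
    s ^ θ * F z ≤ F (s • z) := by
  have hs : 0 < s := one_pos.trans_le hs1
  have := h.monotoneOn hθ hF z (mem_Ioi.2 one_pos) hs hs1
  simp only [Real.one_rpow, one_mul, one_smul] at this
  rwa [Real.rpow_neg hs.le, le_inv_mul_iff₀ (by positivity)] at this

lemma SuperHomogeneous.ray_mono (h : SuperHomogeneous θ F) (hθ : 0 < θ)
    (hF : ContDiff ℝ 1 F) (z : ℝ × ℝ) {s s' : ℝ} (hs : 0 < s) (hss : s ≤ s') :
    F (s • z) ≤ F (s' • z) := by
  have h1 : 1 ≤ s' / s := (one_le_div hs).2 hss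
  have := h.le_of_one_le hθ hF (s • z) h1
  rw [smul_smul, div_mul_cancel₀ _ hs.ne'] at this
  refine le_trans ?_ this
  exact le_mul_of_one_le_left (h.nonneg hθ hF _) (Real.one_le_rpow h1 hθ.le)

/-- Transfers lower bounds on `z · ∇F`, which is what `(F₆)` controls, to the density in the
Pohozaev functional. The factor is positive once `θ > 2 - μ/4`. -/
lemma SuperHomogeneous.mul_zGradF_le_frakF (h : SuperHomogeneous θ F) (hθ : 0 < θ)
    (hF : ContDiff ℝ 1 F) {μ : ℝ} (hμ : 0 ≤ 2 - μ / 4) (z : ℝ × ℝ) :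
    (1 - (2 - μ / 4) / θ) * zGradF F z ≤ frakF μ F z := by
  have h1 : F z ≤ zGradF F z / θ := (le_div_iff₀' hθ).2 (h.mul_le_zGradF hθ hF z)
  have h2 := mul_le_mul_of_nonneg_left h1 hμ
  rw [frakF]
  calc _ = zGradF F z - (2 - μ / 4) * (zGradF F z / θ) := by ring
    _ ≤ _ := by linarith

end

/-- A quantitative form of `(F₆)`. -/
lemma CondF6.exists_lower_bound {F : ℝ × ℝ → ℝ} (h : CondF6 F) :
    ∃ c R : ℝ, 0 < c ∧ ∀ z : ℝ × ℝ, R ≤ |z.1| → R ≤ |z.2| →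
      c * Real.exp (64 * Real.pi ^ 2 * (z.1 ^ 2 + z.2 ^ 2)) ≤ F z * zGradF F z := by
  obtain ⟨ρ, hρ, h⟩ := h
  have hlt : ((ρ / 2 : ℝ) : EReal) < ρ := EReal.coe_lt_coe_iff.2 (half_lt_self hρ)
  have hev := eventually_lt_of_lt_liminf (hlt.trans_le h)
  have hb : bothAtTop.HasBasis (fun _ : ℝ × ℝ => True)
      (fun r => {z : ℝ × ℝ | r.1 ≤ |z.1| ∧ r.2 ≤ |z.2|}) := by
    have := (atTop_basis (α := ℝ)).comap (fun z : ℝ × ℝ => |z.1|) |>.inf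
      ((atTop_basis (α := ℝ)).comap (fun z : ℝ × ℝ => |z.2|))
    refine this.to_hasBasis ?_ ?_
    · rintro ⟨r, s⟩ -
      exact ⟨(r, s), trivial, fun z hz => hz⟩
    · rintro ⟨r, s⟩ -
      exact ⟨(r, s), ⟨trivial, trivial⟩, fun z hz => hz⟩
  obtain ⟨r, -, hr⟩ := hb.eventually_iff.1 hev
  refine ⟨ρ / 2, max r.1 r.2, half_pos hρ, fun z h1 h2 => ?_⟩
  have := hr (x := z) ⟨(le_max_left _ _).trans h1, (le_max_right _ _).trans h2⟩
  rw [EReal.coe_lt_coe_iff, euclNorm, Real.sq_sqrt (by positivity),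
    lt_div_iff₀ (Real.exp_pos _)] at this
  exact this.le

/-! ### The Riesz bilinear form -/

/-- The bilinear form `∬ |x - y|^{-μ} m(x) h(y) dx dy`. -/
def rieszForm (μ : ℝ) (m h : R4 → ℝ) : ℝ :=
  ∫ p : R4 × R4, ‖p.1 - p.2‖ ^ (-μ) * (m p.1 * h p.2)

lemma locallyIntegrable_norm_rpow {μ : ℝ} (hμ : μ < 4) :
    LocallyIntegrable (fun x : R4 => ‖x‖ ^ (-μ)) volume := by
  refine locallyIntegrable_of_norm_le_rpow (C := 1) (α := μ) (by simp) (by simpa using hμ) ?_ ?_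
  · refine Eventually.of_forall fun x => ?_
    rw [Real.norm_of_nonneg (by positivity), one_mul]
  · exact (measurable_norm.pow_const _).aestronglyMeasurable

lemma measurable_rieszKernel (μ : ℝ) :
    Measurable (fun p : R4 × R4 => ‖p.1 - p.2‖ ^ (-μ)) :=
  (measurable_fst.sub measurable_snd).norm.pow_const _

/-- On a bounded set the kernel agrees with the integrand `f(y) g(x - y)` of a convolution of two
integrable functions: an indicator and a truncation of `|x|^(-μ)`. -/
lemma locallyIntegrable_rieszKernel {μ : ℝ} (hμ : μ < 4) :
    LocallyIntegrable (fun p : R4 × R4 => ‖p.1 - p.2‖ ^ (-μ)) volume := by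
  rw [locallyIntegrable_iff]
  intro K hK
  obtain ⟨R, hR⟩ := hK.isBounded.subset_closedBall 0
  set f : R4 → ℝ := (Metric.closedBall 0 R).indicator fun _ => 1
  set g : R4 → ℝ := (Metric.closedBall 0 (2 * R)).indicator fun x => ‖x‖ ^ (-μ)
  have hf : Integrable f volume := by
    refine (integrable_indicator_iff Metric.isClosed_closedBall.measurableSet).2 ?_
    exact integrableOn_const (isCompact_closedBall _ _).measure_lt_top.ne
  have hg : Integrable g volume := by
    refine (integrable_indicator_iff Metric.isClosed_closedBall.measurableSet).2 ?_
    exact (locallyIntegrable_norm_rpow hμ).integrableOn_isCompact (isCompact_closedBall _ _)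
  have hfg := hf.convolution_integrand (ContinuousLinearMap.mul ℝ ℝ) hg
  refine (hfg.integrableOn (s := K)).congr_fun ?_ hK.measurableSet
  intro p hp
  have h0 := hR hp
  rw [mem_closedBall_zero_iff, Prod.norm_def] at h0
  have h1 : ‖p.1‖ ≤ R := (le_max_left _ _).trans h0
  have h2 : ‖p.2‖ ≤ R := (le_max_right _ _).trans h0
  have h3 : ‖p.1 - p.2‖ ≤ 2 * R := (norm_sub_le _ _).trans (by linarith)
  simp [f, g, h2, h3]

lemma hasCompactSupport_tensor {m h : R4 → ℝ} (hm : HasCompactSupport m)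
    (hh : HasCompactSupport h) : HasCompactSupport fun p : R4 × R4 => m p.1 * h p.2 := by
  refine HasCompactSupport.intro (hm.isCompact.prod hh.isCompact) fun p hp => ?_
  rw [mem_prod, not_and_or] at hp
  rcases hp with hp | hp
  · rw [image_eq_zero_of_notMem_tsupport hp, zero_mul]
  · rw [image_eq_zero_of_notMem_tsupport hp, mul_zero]

lemma integrable_rieszKernel_mul {μ : ℝ} (hμ : μ < 4) {H : R4 × R4 → ℝ} (hc : Continuous H)
    (hs : HasCompactSupport H) :
    Integrable (fun p : R4 × R4 => ‖p.1 - p.2‖ ^ (-μ) * H p) volume := by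
  simpa [mul_comm] using
    (locallyIntegrable_rieszKernel hμ).integrable_smul_left_of_hasCompactSupport hc hs

lemma integrable_rieszForm {μ : ℝ} (hμ : μ < 4) {m h : R4 → ℝ} (hm : Continuous m)
    (hms : HasCompactSupport m) (hh : Continuous h) (hhs : HasCompactSupport h) :
    Integrable (fun p : R4 × R4 => ‖p.1 - p.2‖ ^ (-μ) * (m p.1 * h p.2)) volume :=
  integrable_rieszKernel_mul hμ
    ((hm.comp continuous_fst).mul (hh.comp continuous_snd)) (hasCompactSupport_tensor hms hhs)

lemma integral_rieszConv_mul {μ : ℝ} (hμ : μ < 4) {m h : R4 → ℝ} (hm : Continuous m)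
    (hms : HasCompactSupport m) (hh : Continuous h) (hhs : HasCompactSupport h) :
    ∫ x, rieszConv μ h x * m x = rieszForm μ m h := by
  have := integrable_rieszForm hμ hm hms hh hhs
  rw [rieszForm, Measure.volume_eq_prod] at *
  rw [integral_prod _ this]
  congr 1
  ext x
  rw [rieszConv, ← integral_mul_const]
  congr 1
  ext y
  ring

lemma rieszForm_comm (μ : ℝ) (m h : R4 → ℝ) : rieszForm μ m h = rieszForm μ h m := by
  rw [rieszForm, rieszForm, Measure.volume_eq_prod, ← integral_prod_swap]
  congr 1
  ext p
  simp only [Prod.fst_swap, Prod.snd_swap]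
  rw [norm_sub_rev, mul_comm (m _)]

/-- The kernel is homogeneous of degree `-μ` and the integral runs over a space of dimension eight.
-/
lemma rieszForm_comp_smul {μ s : ℝ} (hs : 0 < s) (m h : R4 → ℝ) :
    rieszForm μ (fun x => m (s • x)) (fun x => h (s • x)) = s ^ (μ - 8) * rieszForm μ m h := by
  have : (volume : Measure (R4 × R4)).IsAddHaarMeasure :=
    inferInstanceAs ((volume : Measure R4).prod (volume : Measure R4)).IsAddHaarMeasure
  have h1 := Measure.integral_comp_smul (volume : Measure (R4 × R4))
    (fun p => ‖p.1 - p.2‖ ^ (-μ) * (m p.1 * h p.2)) s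
  have h2 : Module.finrank ℝ (R4 × R4) = 8 := by simp
  have h3 : s ^ (μ - 8) = s ^ μ * |(s ^ 8)⁻¹| := by
    rw [abs_of_pos (by positivity), Real.rpow_sub hs, div_eq_mul_inv]
    norm_cast
  rw [h2, smul_eq_mul] at h1
  rw [rieszForm, rieszForm, h3, mul_assoc, ← h1, ← integral_const_mul]
  congr 1
  ext p
  simp only [Prod.smul_fst, Prod.smul_snd]
  rw [← smul_sub, norm_smul, Real.norm_of_nonneg hs.le,
    Real.mul_rpow hs.le (norm_nonneg _), Real.rpow_neg hs.le]
  field_simp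

lemma rieszForm_smul (μ c d : ℝ) (m h : R4 → ℝ) :
    rieszForm μ (fun x => c * m x) (fun x => d * h x) = c * d * rieszForm μ m h := by
  rw [rieszForm, rieszForm, ← integral_const_mul]
  congr 1
  ext p
  ring

lemma rieszForm_mono {μ : ℝ} (hμ : μ < 4) {m h m' h' : R4 → ℝ} (hm : Continuous m)
    (hms : HasCompactSupport m) (hh : Continuous h) (hhs : HasCompactSupport h)
    (hm' : Continuous m') (hms' : HasCompactSupport m') (hh' : Continuous h')
    (hhs' : HasCompactSupport h') (h0m : ∀ x, 0 ≤ m x) (h0h : ∀ x, 0 ≤ h x)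
    (hmm : ∀ x, m x ≤ m' x) (hhh : ∀ x, h x ≤ h' x) : rieszForm μ m h ≤ rieszForm μ m' h' := by
  refine integral_mono (integrable_rieszForm hμ hm hms hh hhs)
    (integrable_rieszForm hμ hm' hms' hh' hhs') fun p => ?_
  exact mul_le_mul_of_nonneg_left (mul_le_mul (hmm _) (hhh _) (h0h _) ((h0m _).trans (hmm _)))
    (by positivity)

lemma rieszForm_nonneg {μ : ℝ} {m h : R4 → ℝ} (h0m : ∀ x, 0 ≤ m x) (h0h : ∀ x, 0 ≤ h x) :
    0 ≤ rieszForm μ m h :=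
  integral_nonneg fun p => mul_nonneg (by positivity) (mul_nonneg (h0m _) (h0h _))

lemma le_rieszForm {μ : ℝ} (hμ : μ < 4) {m h : R4 → ℝ} (hm : Continuous m)
    (hms : HasCompactSupport m) (hh : Continuous h) (hhs : HasCompactSupport h)
    (h0m : ∀ x, 0 ≤ m x) (h0h : ∀ x, 0 ≤ h x) {A B : Set R4} (hA : MeasurableSet A)
    (hB : MeasurableSet B) (hAf : volume A ≠ ⊤) (hBf : volume B ≠ ⊤) {κ c : ℝ} (hc : 0 ≤ c)
    (hκ : ∀ x ∈ A, ∀ y ∈ B, κ ≤ ‖x - y‖ ^ (-μ))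
    (hmh : ∀ x ∈ A, ∀ y ∈ B, c ≤ m x * h y) :
    κ * c * (volume.real A * volume.real B) ≤ rieszForm μ m h := by
  have hint := integrable_rieszForm hμ hm hms hh hhs
  have h1 : ∫ p in A ×ˢ B, ‖p.1 - p.2‖ ^ (-μ) * (m p.1 * h p.2) ≤ rieszForm μ m h :=
    setIntegral_le_integral hint (Eventually.of_forall fun p =>
      mul_nonneg (by positivity) (mul_nonneg (h0m _) (h0h _)))
  refine le_trans ?_ h1
  have hfin : volume (A ×ˢ B) ≠ ⊤ := by
    rw [Measure.volume_eq_prod, Measure.prod_prod]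
    exact ENNReal.mul_ne_top hAf hBf
  have h2 := setIntegral_mono_on (integrableOn_const (C := κ * c) hfin) hint.integrableOn
    (hA.prod hB) (fun p hp => ?_)
  · rw [setIntegral_const, smul_eq_mul, mul_comm] at h2
    convert h2 using 2
    rw [Measure.real, Measure.real, Measure.real, Measure.volume_eq_prod, Measure.prod_prod,
      ENNReal.toReal_mul]
  · exact mul_le_mul (hκ _ hp.1 _ hp.2) (hmh _ hp.1 _ hp.2) hc (by positivity)

/-! ### Differentiation of the Riesz energy along rays -/

section

variable {F : ℝ × ℝ → ℝ} {w : R4 → ℝ × ℝ}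

lemma hasCompactSupport_comp_smul {G : ℝ × ℝ → ℝ} (hG : G 0 = 0) (hw : HasCompactSupport w)
    (t : ℝ) : HasCompactSupport fun x => G (t • w x) :=
  hw.comp_left (g := fun z => G (t • z)) (by simp [hG])

lemma continuous_comp_smul {G : ℝ × ℝ → ℝ} (hG : Continuous G) (hw : Continuous w) (t : ℝ) :
    Continuous fun x => G (t • w x) := by fun_prop

/-- Differentiation under the integral; by symmetry of the kernel the two product-rule terms agree,
whence the factor two. -/
lemma hasDerivAt_rieszForm {μ : ℝ} (hμ : μ < 4) (hF : ContDiff ℝ 1 F) (hF0 : F 0 = 0)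
    (hw : Continuous w) (hws : HasCompactSupport w) {t₀ : ℝ} (ht₀ : 0 < t₀) :
    HasDerivAt (fun t => rieszForm μ (fun x => F (t • w x)) (fun x => F (t • w x)))
      (2 * t₀⁻¹ * rieszForm μ (fun x => zGradF F (t₀ • w x)) (fun x => F (t₀ • w x))) t₀ := by
  have hz := continuous_zGradF hF
  obtain ⟨W, hW⟩ := hw.bounded_above_of_compact_support hws
  have hW0 : 0 ≤ W := (norm_nonneg _).trans (hW 0)
  set B := Metric.closedBall (0 : ℝ × ℝ) (2 * t₀ * W)
  obtain ⟨M, hM⟩ := (isCompact_closedBall (0 : ℝ × ℝ) (2 * t₀ * W)).exists_bound_of_continuousOn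
    hF.continuous.continuousOn
  obtain ⟨M', hM'⟩ := (isCompact_closedBall (0 : ℝ × ℝ) (2 * t₀ * W)).exists_bound_of_continuousOn
    hz.continuousOn
  have hB0 : (0 : ℝ × ℝ) ∈ B := Metric.mem_closedBall_self (by positivity)
  have hM0 : 0 ≤ M := (norm_nonneg _).trans (hM 0 hB0)
  have hM0' : 0 ≤ M' := (norm_nonneg _).trans (hM' 0 hB0)
  set K := tsupport w ×ˢ tsupport w
  have hK : IsCompact K := hws.isCompact.prod hws.isCompact
  set D : ℝ → R4 × R4 → ℝ := fun t p => ‖p.1 - p.2‖ ^ (-μ) *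
    (t⁻¹ * zGradF F (t • w p.1) * F (t • w p.2) + F (t • w p.1) * (t⁻¹ * zGradF F (t • w p.2)))
    with hD
  -- For `t` in `(t₀/2, 2t₀)` the values `t • w x` stay in `B` and `t⁻¹ ≤ (t₀/2)⁻¹`, so the kernel
  -- cut to `K`, times a constant, dominates the derivative.
  set bound : R4 × R4 → ℝ := K.indicator fun p =>
    ‖p.1 - p.2‖ ^ (-μ) * ((t₀ / 2)⁻¹ * (2 * (M' * M))) with hbound
  have hsmem : Ioo (t₀ / 2) (2 * t₀) ∈ 𝓝 t₀ := Ioo_mem_nhds (by linarith) (by linarith)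
  have hFi : ∀ t, Integrable (fun p : R4 × R4 =>
      ‖p.1 - p.2‖ ^ (-μ) * (F (t • w p.1) * F (t • w p.2))) volume := fun t =>
    integrable_rieszForm hμ (continuous_comp_smul hF.continuous hw t)
      (hasCompactSupport_comp_smul hF0 hws t) (continuous_comp_smul hF.continuous hw t)
      (hasCompactSupport_comp_smul hF0 hws t)
  have hDm : AEStronglyMeasurable (D t₀) volume := by
    refine ((measurable_rieszKernel μ).mul ?_).aestronglyMeasurable
    refine Continuous.measurable ?_
    have := hF.continuous
    fun_prop
  have hbi : Integrable bound volume := by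
    refine (integrable_indicator_iff hK.measurableSet).2 ?_
    exact ((locallyIntegrable_rieszKernel hμ).integrableOn_isCompact hK).mul_const _
  have hb : ∀ p : R4 × R4, ∀ t ∈ Ioo (t₀ / 2) (2 * t₀), ‖D t p‖ ≤ bound p := by
    intro p t ht
    have ht0 : 0 < t := (half_pos ht₀).trans ht.1
    by_cases hp : p ∈ K
    · have hmem : ∀ x, t • w x ∈ B := fun x => by
        rw [mem_closedBall_zero_iff, norm_smul, Real.norm_of_nonneg ht0.le]
        exact mul_le_mul ht.2.le (hW x) (norm_nonneg _) (by positivity)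
      have hti : t⁻¹ ≤ (t₀ / 2)⁻¹ := by
        gcongr
        exact ht.1.le
      rw [hbound, indicator_of_mem hp, hD]
      simp only
      rw [norm_mul, Real.norm_of_nonneg (by positivity)]
      refine mul_le_mul_of_nonneg_left ((norm_add_le _ _).trans ?_) (by positivity)
      simp only [norm_mul]
      rw [Real.norm_of_nonneg (inv_pos.2 ht0).le]
      have a1 := hM _ (hmem p.1)
      have a2 := hM _ (hmem p.2)
      have b1 := hM' _ (hmem p.1)
      have b2 := hM' _ (hmem p.2)
      have c1 : t⁻¹ * ‖zGradF F (t • w p.1)‖ * ‖F (t • w p.2)‖ ≤ (t₀ / 2)⁻¹ * M' * M := by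
        gcongr
      have c2 : ‖F (t • w p.1)‖ * (t⁻¹ * ‖zGradF F (t • w p.2)‖) ≤ M * ((t₀ / 2)⁻¹ * M') := by
        gcongr
      linarith
    · have h0 : w p.1 = 0 ∨ w p.2 = 0 := by
        rw [mem_prod, not_and_or] at hp
        exact hp.imp image_eq_zero_of_notMem_tsupport image_eq_zero_of_notMem_tsupport
      rw [hbound, indicator_of_notMem hp, hD]
      rcases h0 with h0 | h0 <;> simp [h0, hF0, zGradF_zero]
  have hd : ∀ p : R4 × R4, ∀ t ∈ Ioo (t₀ / 2) (2 * t₀), HasDerivAt (fun t =>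
      ‖p.1 - p.2‖ ^ (-μ) * (F (t • w p.1) * F (t • w p.2))) (D t p) t := by
    intro p t ht
    have ht0 : t ≠ 0 := ((half_pos ht₀).trans ht.1).ne'
    exact ((hasDerivAt_ray hF (w p.1) ht0).mul (hasDerivAt_ray hF (w p.2) ht0)).const_mul _
  have key := (hasDerivAt_integral_of_dominated_loc_of_deriv_le hsmem
    (Eventually.of_forall fun t => (hFi t).aestronglyMeasurable) (hFi t₀) hDm
    (Eventually.of_forall hb) hbi (Eventually.of_forall hd)).2
  have hI1 := integrable_rieszForm hμ (continuous_comp_smul hz hw t₀)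
    (hasCompactSupport_comp_smul (zGradF_zero F) hws t₀)
    (continuous_comp_smul hF.continuous hw t₀) (hasCompactSupport_comp_smul hF0 hws t₀)
  have hI2 := integrable_rieszForm hμ (continuous_comp_smul hF.continuous hw t₀)
    (hasCompactSupport_comp_smul hF0 hws t₀) (continuous_comp_smul hz hw t₀)
    (hasCompactSupport_comp_smul (zGradF_zero F) hws t₀)
  have hval : ∫ p, D t₀ p = 2 * t₀⁻¹ *
      rieszForm μ (fun x => zGradF F (t₀ • w x)) (fun x => F (t₀ • w x)) := by
    have e : D t₀ = fun p => t₀⁻¹ * (‖p.1 - p.2‖ ^ (-μ) * (zGradF F (t₀ • w p.1) * F (t₀ • w p.2)))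
        + t₀⁻¹ * (‖p.1 - p.2‖ ^ (-μ) * (F (t₀ • w p.1) * zGradF F (t₀ • w p.2))) := by
      ext p
      rw [hD]
      ring
    have e2 := rieszForm_comm μ (fun x => F (t₀ • w x)) (fun x => zGradF F (t₀ • w x))
    rw [e, integral_add (hI1.const_mul _) (hI2.const_mul _), integral_const_mul,
      integral_const_mul]
    simp only [rieszForm] at e2 ⊢
    rw [e2]
    ring
  rw [hval] at key
  exact key

end

/-! ### Compactly supported functions with Lipschitz gradient -/

/-- `u` is a compactly supported Lipschitz function whose partial derivatives `g i` are
Lipschitz. -/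
structure HasLipschitzGradient (u : R4 → ℝ) (g : Fin 4 → R4 → ℝ) : Prop where
  lipschitz : ∃ C, LipschitzWith C u
  hasCompactSupport : HasCompactSupport u
  lineDeriv_eq : ∀ i x, lineDeriv ℝ u x (EuclideanSpace.single i 1) = g i x
  lipschitz_grad : ∀ i, ∃ C, LipschitzWith C (g i)

/-- The pointwise divergence of `g`. -/
def lineDivergence (g : Fin 4 → R4 → ℝ) (x : R4) : ℝ :=
  ∑ i, lineDeriv ℝ (g i) x (EuclideanSpace.single i 1)

lemma hasCompactSupport_lineDeriv {u : R4 → ℝ} (hu : HasCompactSupport u) (v : R4) :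
    HasCompactSupport fun x => lineDeriv ℝ u x v := by
  refine HasCompactSupport.intro hu.isCompact fun x hx => ?_
  have h : u =ᶠ[𝓝 x] fun _ => 0 := notMem_tsupport_iff_eventuallyEq.1 hx
  rw [h.lineDeriv_eq, lineDeriv]
  simp

/-- Integration by parts of a Lipschitz function against a test function, so one bounded derivative
beyond the gradient suffices for `H²`. -/
lemma isWeakPartial_lineDeriv {u : R4 → ℝ} {C : NNReal} (hu : LipschitzWith C u) (i : Fin 4) :
    IsWeakPartial i u fun x => lineDeriv ℝ u x (EuclideanSpace.single i 1) := by
  intro φ hφ hφs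
  obtain ⟨D, hD⟩ := ContDiff.lipschitzWith_of_hasCompactSupport hφs hφ (by simp)
  rw [hu.integral_lineDeriv_mul_eq hD hφs, ← integral_neg]
  congr 1
  ext x
  rw [lineDeriv_neg, ((hφ.differentiable (by simp)) x).lineDeriv_eq_fderiv]
  ring

lemma memLp_two_of_bounded {f : R4 → ℝ} (hm : AEStronglyMeasurable f volume)
    (hs : HasCompactSupport f) {C : ℝ} (hC : ∀ x, ‖f x‖ ≤ C) : MemLp f 2 volume := by
  have h1 : MemLp f 2 (volume.restrict (tsupport f)) := by
    have : IsFiniteMeasure (volume.restrict (tsupport f)) :=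
      ⟨by rw [Measure.restrict_apply_univ]; exact hs.isCompact.measure_lt_top⟩
    exact MemLp.of_bound hm.restrict C (Eventually.of_forall hC)
  have h2 := (memLp_indicator_iff_restrict (isClosed_tsupport f).measurableSet).2 h1
  rwa [indicator_eq_self.2 (subset_tsupport f)] at h2

lemma memLp_two_lineDeriv {u : R4 → ℝ} {C : NNReal} (hu : LipschitzWith C u)
    (hs : HasCompactSupport u) (v : R4) : MemLp (fun x => lineDeriv ℝ u x v) 2 volume :=
  memLp_two_of_bounded (measurable_lineDeriv hu.continuous).aestronglyMeasurable
    (hasCompactSupport_lineDeriv hs v) fun _ => norm_lineDeriv_le_of_lipschitz ℝ hu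

namespace HasLipschitzGradient

variable {u : R4 → ℝ} {g : Fin 4 → R4 → ℝ}

lemma continuous (h : HasLipschitzGradient u g) : Continuous u :=
  h.lipschitz.choose_spec.continuous

lemma hasCompactSupport_grad (h : HasLipschitzGradient u g) (i : Fin 4) :
    HasCompactSupport (g i) := by
  have := hasCompactSupport_lineDeriv h.hasCompactSupport (EuclideanSpace.single i 1)
  simpa only [h.lineDeriv_eq] using this

lemma isWeakPartial (h : HasLipschitzGradient u g) (i : Fin 4) : IsWeakPartial i u (g i) := by
  obtain ⟨C, hC⟩ := h.lipschitz
  simpa only [h.lineDeriv_eq] using isWeakPartial_lineDeriv hC i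

lemma memH2 (h : HasLipschitzGradient u g) : MemH2 u := by
  obtain ⟨C, hC⟩ := h.lipschitz
  refine ⟨h.continuous.memLp_of_hasCompactSupport h.hasCompactSupport, g,
    fun i j x => lineDeriv ℝ (g i) x (EuclideanSpace.single j 1), fun i => ⟨?_, h.isWeakPartial i⟩,
    fun i j => ?_⟩
  · obtain ⟨D, hD⟩ := h.lipschitz_grad i
    exact hD.continuous.memLp_of_hasCompactSupport (h.hasCompactSupport_grad i)
  · obtain ⟨D, hD⟩ := h.lipschitz_grad i
    exact ⟨memLp_two_lineDeriv hD (h.hasCompactSupport_grad i) _, isWeakPartial_lineDeriv hD j⟩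

lemma memLp_lineDivergence (h : HasLipschitzGradient u g) :
    MemLp (lineDivergence g) 2 volume := by
  refine memLp_finsetSum _ fun i _ => ?_
  obtain ⟨D, hD⟩ := h.lipschitz_grad i
  exact memLp_two_lineDeriv hD (h.hasCompactSupport_grad i) _

end HasLipschitzGradient

lemma locallyIntegrable_mul_test {f φ : R4 → ℝ} (hf : LocallyIntegrable f volume)
    (hφ : Continuous φ) (hφs : HasCompactSupport φ) : Integrable (fun x => f x * φ x) volume := by
  simpa [mul_comm] using hf.integrable_smul_left_of_hasCompactSupport hφ hφs

/-- Two integrations by parts in each direction: the first, with test function `∂ᵢφ`, uses that `u`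
is Lipschitz, the second that `g i` is. -/
lemma HasLipschitzGradient.isWeakLaplacian {u : R4 → ℝ} {g : Fin 4 → R4 → ℝ}
    (h : HasLipschitzGradient u g) : IsWeakLaplacian u (lineDivergence g) := by
  intro φ hφ hφs
  set e : Fin 4 → R4 := fun i => EuclideanSpace.single i 1
  set ψ : Fin 4 → R4 → ℝ := fun i x => fderiv ℝ φ x (e i) with hψ
  have hψc : ∀ i, ContDiff ℝ ∞ (ψ i) := fun i =>
    (hφ.fderiv_right (m := ∞) (by simp)).clm_apply contDiff_const
  have hψs : ∀ i, HasCompactSupport (ψ i) := fun i => hφs.fderiv_apply ℝ (e i)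
  have hlap : ∀ x, Laplacian.laplacian φ x = ∑ i, fderiv ℝ (ψ i) x (e i) := by
    intro x
    rw [InnerProductSpace.laplacian_eq_iteratedFDeriv_orthonormalBasis φ
      (EuclideanSpace.basisFun (Fin 4) ℝ)]
    refine Finset.sum_congr rfl fun i _ => ?_
    have hd : DifferentiableAt ℝ (fderiv ℝ φ) x :=
      (hφ.fderiv_right (m := ∞) (by simp)).differentiable (by simp) x
    rw [iteratedFDeriv_two_apply, hψ]
    simp only [Matrix.cons_val_zero, Matrix.cons_val_one, EuclideanSpace.basisFun_apply]
    rw [fderiv_clm_apply hd (differentiableAt_const _)]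
    simp [e]
  have hψd : ∀ i, Continuous fun x => fderiv ℝ (ψ i) x (e i) := fun i =>
    ((hψc i).continuous_fderiv (by simp)).clm_apply continuous_const
  have hint : ∀ i, Integrable (fun x => u x * fderiv ℝ (ψ i) x (e i)) volume := fun i =>
    locallyIntegrable_mul_test h.continuous.locallyIntegrable (hψd i)
      ((hψs i).fderiv_apply ℝ (e i))
  have hli : ∀ i, LocallyIntegrable (fun x => lineDeriv ℝ (g i) x (e i)) volume := fun i => by
    obtain ⟨D, hD⟩ := h.lipschitz_grad i
    exact hD.locallyIntegrable_lineDeriv (e i)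
  simp only [hlap, lineDivergence, Finset.mul_sum, Finset.sum_mul]
  rw [integral_finsetSum _ fun i _ => hint i,
    integral_finsetSum _ fun i _ => locallyIntegrable_mul_test (hli i) hφ.continuous hφs]
  refine Finset.sum_congr rfl fun i _ => ?_
  obtain ⟨D, hD⟩ := h.lipschitz_grad i
  rw [h.isWeakPartial i (ψ i) (hψc i) (hψs i)]
  have := isWeakPartial_lineDeriv hD i φ hφ hφs
  rw [hψ]
  simp only
  rw [this, neg_neg]

/-- The weak Laplacian is unique almost everywhere. -/
lemma weakLaplacian_ae_eq {u f : R4 → ℝ} (hf : LocallyIntegrable f volume)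
    (hu : IsWeakLaplacian u f) : weakLaplacian u =ᵐ[volume] f := by
  have hex : ∃ f : R4 → ℝ, LocallyIntegrable f volume ∧ IsWeakLaplacian u f := ⟨f, hf, hu⟩
  have hspec := hex.choose_spec
  have hw : weakLaplacian u = hex.choose := by rw [weakLaplacian, dif_pos hex]
  rw [← hw] at hspec
  have := ae_eq_zero_of_integral_contDiff_smul_eq_zero (hspec.1.sub hf) fun φ hφ hφs => by
    have h1 := hspec.2 φ hφ hφs
    have h2 := hu φ hφ hφs
    rw [h1] at h2
    have i1 := locallyIntegrable_mul_test hspec.1 hφ.continuous hφs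
    have i2 := locallyIntegrable_mul_test hf hφ.continuous hφs
    have h3 := integral_sub i1 i2
    rw [h2, sub_self] at h3
    rw [← h3]
    congr 1
    ext x
    simp only [Pi.sub_apply, smul_eq_mul]
    ring
  filter_upwards [this] with x hx
  exact sub_eq_zero.1 hx

lemma HasLipschitzGradient.weakLaplacian_ae_eq {u : R4 → ℝ} {g : Fin 4 → R4 → ℝ}
    (h : HasLipschitzGradient u g) : weakLaplacian u =ᵐ[volume] lineDivergence g :=
  BiharmonicChoquard.weakLaplacian_ae_eq
    (h.memLp_lineDivergence.locallyIntegrable (by norm_num)) h.isWeakLaplacian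

lemma HasLipschitzGradient.laplaceEnergy_eq {u v : R4 → ℝ} {g k : Fin 4 → R4 → ℝ}
    (hu : HasLipschitzGradient u g) (hv : HasLipschitzGradient v k) :
    laplaceEnergy u v = (∫ x, lineDivergence g x ^ 2) + ∫ x, lineDivergence k x ^ 2 := by
  rw [laplaceEnergy, ← integral_add hu.memLp_lineDivergence.integrable_sq
    hv.memLp_lineDivergence.integrable_sq]
  refine integral_congr_ae ?_
  filter_upwards [hu.weakLaplacian_ae_eq, hv.weakLaplacian_ae_eq] with x h1 h2
  rw [h1, h2]

lemma lineDeriv_const_mul_comp_smul (u : R4 → ℝ) (c s : ℝ) (x v : R4) :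
    lineDeriv ℝ (fun x => c * u (s • x)) x v = c * s * lineDeriv ℝ u (s • x) v := by
  have e : (fun t : ℝ => c * u (s • (x + t • v))) =
      fun t : ℝ => c * (fun r : ℝ => u (s • x + r • v)) (s * t) := by
    ext t
    simp only [smul_add, smul_smul]
  rw [lineDeriv, lineDeriv, e, deriv_const_mul_field,
    deriv_comp_mul_left s (fun r : ℝ => u (s • x + r • v)), mul_zero, smul_eq_mul, mul_assoc]

lemma exists_lipschitz_const_mul_comp_smul {u : R4 → ℝ} (h : ∃ C, LipschitzWith C u) (c s : ℝ) :
    ∃ C, LipschitzWith C fun x => c * u (s • x) := by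
  obtain ⟨C, hC⟩ := h
  exact ⟨_, (lipschitzWith_smul c).comp (hC.comp (lipschitzWith_smul s))⟩

lemma HasLipschitzGradient.const_mul_comp_smul {u : R4 → ℝ} {g : Fin 4 → R4 → ℝ}
    (h : HasLipschitzGradient u g) (c : ℝ) {s : ℝ} (hs : s ≠ 0) :
    HasLipschitzGradient (fun x => c * u (s • x)) fun i x => c * s * g i (s • x) where
  lipschitz := exists_lipschitz_const_mul_comp_smul h.lipschitz c s
  hasCompactSupport := (h.hasCompactSupport.comp_smul hs).mul_left
  lineDeriv_eq i x := by rw [lineDeriv_const_mul_comp_smul, h.lineDeriv_eq]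
  lipschitz_grad i := exists_lipschitz_const_mul_comp_smul (h.lipschitz_grad i) _ s

/-- The two derivatives contribute `s²`, squared to `s⁴`, which cancels the Jacobian `s⁻⁴` of the
dilation in dimension four. -/
lemma integral_lineDivergence_sq_comp_smul (g : Fin 4 → R4 → ℝ) (c : ℝ) {s : ℝ} (hs : 0 < s) :
    ∫ x, lineDivergence (fun i x => c * s * g i (s • x)) x ^ 2 =
      c ^ 2 * ∫ x, lineDivergence g x ^ 2 := by
  have e : ∀ x, lineDivergence (fun i x => c * s * g i (s • x)) x ^ 2 =
      c ^ 2 * s ^ 4 * (fun y => lineDivergence g y ^ 2) (s • x) := by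
    intro x
    simp only [lineDivergence, lineDeriv_const_mul_comp_smul, ← Finset.mul_sum]
    ring
  rw [integral_congr_ae (Eventually.of_forall e), integral_const_mul,
    Measure.integral_comp_smul volume (fun y => lineDivergence g y ^ 2),
    finrank_euclideanSpace_fin, smul_eq_mul, abs_of_pos (by positivity)]
  field_simp

/-! ### Radial functions with Lipschitz slope -/

/-- The gradient of `x ↦ η (‖x‖²)` when `e` is the derivative of `η`. -/
def radialGrad (e : ℝ → ℝ) (i : Fin 4) (x : R4) : ℝ := 2 * x i * e (‖x‖ ^ 2)

section

variable {η e : ℝ → ℝ} {K : NNReal}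

lemma abs_slope_le (he : LipschitzWith K e) (he0 : ∀ s, 4 ≤ s → e s = 0) {s : ℝ} (hs : 0 ≤ s) :
    |e s| ≤ 4 * K := by
  rcases le_total 4 s with h | h
  · rw [he0 s h, abs_zero]
    positivity
  · have := he.dist_le_mul s 4
    rw [he0 4 le_rfl, Real.dist_eq, Real.dist_eq, sub_zero,
      abs_of_nonpos (a := s - 4) (by linarith)] at this
    nlinarith [K.coe_nonneg]

lemma hasFDerivAt_radial {x : R4} {η' : ℝ} (hη : HasDerivAt η η' (‖x‖ ^ 2)) :
    HasFDerivAt (fun x : R4 => η (‖x‖ ^ 2)) ((2 * η') • innerSL ℝ x) x := by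
  have h := hη.comp_hasFDerivAt x (hasStrictFDerivAt_norm_sq x).hasFDerivAt
  rwa [← ofNat_smul_eq_nsmul ℝ, smul_smul, mul_comm] at h

lemma inner_single (x : R4) (i : Fin 4) :
    inner ℝ x (EuclideanSpace.single i (1 : ℝ)) = x i := by
  simp [EuclideanSpace.inner_single_right]

lemma abs_coord_le (x : R4) (i : Fin 4) : |x i| ≤ ‖x‖ := by
  simpa using PiLp.norm_apply_le x i

/-- Used with `p`, `q` the norms of two points and `c` a coordinate of the point nearer the origin.
Squaring is Lipschitz only on bounded sets, but `e (r ^ 2)` vanishes for `r ≥ 2`. -/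
lemma abs_coord_mul_sub_le (he : LipschitzWith K e) (he0 : ∀ s, 4 ≤ s → e s = 0) {c p q : ℝ}
    (hc : |c| ≤ q) (hqp : q ≤ p) : |c * (e (p ^ 2) - e (q ^ 2))| ≤ 8 * K * (p - q) := by
  have hK := K.coe_nonneg
  have hq : 0 ≤ q := (abs_nonneg c).trans hc
  have hd : ∀ r, q ≤ r → r ≤ 2 → |e (r ^ 2) - e (q ^ 2)| ≤ 4 * K * (r - q) := by
    intro r hqr hr
    have h1 := he.dist_le_mul (r ^ 2) (q ^ 2)
    rw [Real.dist_eq, Real.dist_eq, abs_of_nonneg (a := r ^ 2 - q ^ 2) (by nlinarith)] at h1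
    refine h1.trans ?_
    have : r ^ 2 - q ^ 2 ≤ 4 * (r - q) := by nlinarith
    nlinarith
  rw [abs_mul]
  rcases le_total q 2 with hq2 | hq2
  · have key : |e (p ^ 2) - e (q ^ 2)| ≤ 4 * K * (p - q) := by
      rcases le_total p 2 with hp | hp
      · exact hd p hqp hp
      · rw [he0 (p ^ 2) (by nlinarith), ← he0 (2 ^ 2) (by norm_num)]
        refine (hd 2 hq2 le_rfl).trans ?_
        gcongr
    calc |c| * |e (p ^ 2) - e (q ^ 2)| ≤ 2 * (4 * K * (p - q)) := by
          gcongr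
          exact hc.trans hq2
      _ = _ := by ring
  · rw [he0 (p ^ 2) (by nlinarith), he0 (q ^ 2) (by nlinarith), sub_zero, abs_zero, mul_zero]
    have : 0 ≤ p - q := sub_nonneg.2 hqp
    positivity

lemma lipschitzWith_radialGrad (he : LipschitzWith K e) (he0 : ∀ s, 4 ≤ s → e s = 0)
    (i : Fin 4) : LipschitzWith (24 * K) (radialGrad e i) := by
  have key : ∀ x y : R4, ‖y‖ ≤ ‖x‖ → dist (radialGrad e i x) (radialGrad e i y) ≤
      24 * K * dist x y := by
    intro x y hxy
    have hsplit : radialGrad e i x - radialGrad e i y =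
        2 * ((x - y) i * e (‖x‖ ^ 2)) + 2 * (y i * (e (‖x‖ ^ 2) - e (‖y‖ ^ 2))) := by
      simp only [radialGrad, PiLp.sub_apply]
      ring
    rw [Real.dist_eq, dist_eq_norm, hsplit]
    have h1 : |(x - y) i * e (‖x‖ ^ 2)| ≤ ‖x - y‖ * (4 * K) := by
      rw [abs_mul]
      exact mul_le_mul (abs_coord_le _ _) (abs_slope_le he he0 (by positivity)) (abs_nonneg _)
        (norm_nonneg _)
    have h2 := abs_coord_mul_sub_le he he0 (abs_coord_le y i) hxy
    have h3 : ‖x‖ - ‖y‖ ≤ ‖x - y‖ := norm_sub_norm_le x y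
    have h4 : 8 * K * (‖x‖ - ‖y‖) ≤ 8 * K * ‖x - y‖ := by gcongr
    calc _ ≤ |2 * ((x - y) i * e (‖x‖ ^ 2))| + |2 * (y i * (e (‖x‖ ^ 2) - e (‖y‖ ^ 2)))| :=
          abs_add_le _ _
      _ = 2 * |(x - y) i * e (‖x‖ ^ 2)| + 2 * |y i * (e (‖x‖ ^ 2) - e (‖y‖ ^ 2))| := by
          rw [abs_mul 2, abs_mul 2, abs_two]
      _ ≤ _ := by linarith
  refine LipschitzWith.of_dist_le_mul fun x y => ?_
  rw [NNReal.coe_mul, NNReal.coe_ofNat]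
  rcases le_total ‖y‖ ‖x‖ with h | h
  · exact key x y h
  · rw [dist_comm, dist_comm x y]
    exact key y x h

lemma hasLipschitzGradient_radial (hη : ∀ s, HasDerivAt η (e s) s) (hη0 : ∀ s, 4 ≤ s → η s = 0)
    (he : LipschitzWith K e) (he0 : ∀ s, 4 ≤ s → e s = 0) :
    HasLipschitzGradient (fun x : R4 => η (‖x‖ ^ 2)) (radialGrad e) where
  lipschitz := by
    refine ⟨16 * K, lipschitzWith_of_nnnorm_fderiv_le (𝕜 := ℝ)
      (fun x => (hasFDerivAt_radial (hη _)).differentiableAt) fun x => ?_⟩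
    rw [(hasFDerivAt_radial (hη _)).fderiv, ← NNReal.coe_le_coe, coe_nnnorm, norm_smul,
      Real.norm_eq_abs, NNReal.coe_mul, NNReal.coe_ofNat, innerSL_apply_norm, abs_mul, abs_two]
    rcases le_total ‖x‖ 2 with h | h
    · calc 2 * |e (‖x‖ ^ 2)| * ‖x‖ ≤ 2 * (4 * K) * 2 := by
            gcongr
            exact abs_slope_le he he0 (by positivity)
        _ = _ := by ring
    · rw [he0 _ (by nlinarith), abs_zero, mul_zero, zero_mul]
      positivity
  hasCompactSupport := by
    refine HasCompactSupport.intro (isCompact_closedBall (0 : R4) 2) fun x hx => hη0 _ ?_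
    rw [mem_closedBall_zero_iff, not_le] at hx
    nlinarith
  lineDeriv_eq i x := by
    rw [(hasFDerivAt_radial (hη _)).differentiableAt.lineDeriv_eq_fderiv,
      (hasFDerivAt_radial (hη _)).fderiv]
    simp only [smul_apply, innerSL_apply_apply, inner_single, radialGrad, smul_eq_mul]
    ring
  lipschitz_grad i := ⟨_, lipschitzWith_radialGrad he he0 i⟩

/-- The Laplacian of `η(‖x‖²)` in dimension four; the coefficient `8` is `2 · 4`. -/
lemma lineDivergence_radialGrad {x : R4} {e' : ℝ} (he : HasDerivAt e e' (‖x‖ ^ 2)) :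
    lineDivergence (radialGrad e) x = 8 * e (‖x‖ ^ 2) + 4 * ‖x‖ ^ 2 * e' := by
  have h : ∀ i : Fin 4, lineDeriv ℝ (radialGrad e i) x (EuclideanSpace.single i 1) =
      2 * e (‖x‖ ^ 2) + 4 * e' * x i ^ 2 := by
    intro i
    have hx : HasFDerivAt (fun x : R4 => 2 * x i) ((2 : ℝ) • (EuclideanSpace.proj i : R4 →L[ℝ] ℝ)) x :=
      (EuclideanSpace.proj (𝕜 := ℝ) i : R4 →L[ℝ] ℝ).hasFDerivAt.const_mul 2
    have hd : HasFDerivAt (radialGrad e i) _ x := hx.mul (hasFDerivAt_radial he)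
    rw [hd.differentiableAt.lineDeriv_eq_fderiv, hd.fderiv]
    simp only [add_apply, smul_apply, innerSL_apply_apply, inner_single, smul_eq_mul]
    simp
    ring
  have hn : ‖x‖ ^ 2 = ∑ i, x i ^ 2 := by
    rw [EuclideanSpace.norm_sq_eq]
    simp
  rw [lineDivergence, Finset.sum_congr rfl fun i _ => h i, Finset.sum_add_distrib,
    ← Finset.mul_sum (a := 4 * e'), ← hn]
  simp
  ring

end

/-! ### The Adams profile as a function of `‖x‖²` -/

/-- A smooth truncation of `s ↦ log √s`. -/
structure IsLogTruncation (Φ : ℝ → ℝ) : Prop where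
  contDiffOn : ContDiffOn ℝ ∞ Φ (Ioi 0)
  eq_log : ∀ s, 0 < s → s ≤ 1 → Φ s = Real.log s / 2
  eq_zero : ∀ s, 4 ≤ s → Φ s = 0

lemma IsCutoff.isLogTruncation {φ : ℝ → ℝ} (hφ : IsCutoff φ) :
    IsLogTruncation fun s => φ (√s) * (Real.log s / 2) where
  contDiffOn := by
    have h1 : ContDiffOn ℝ ∞ (fun s : ℝ => √s) (Ioi 0) := fun s hs =>
      (Real.contDiffAt_sqrt (ne_of_gt hs)).contDiffWithinAt
    have h2 : ContDiffOn ℝ ∞ Real.log (Ioi 0) := fun s hs =>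
      (Real.contDiffAt_log.2 (ne_of_gt hs)).contDiffWithinAt
    exact (hφ.1.comp h1 fun s _ => Real.sqrt_nonneg s).mul (h2.div_const 2)
  eq_log s hs hs1 := by
    rw [hφ.2.2.1 _ (Real.sqrt_nonneg s) (Real.sqrt_le_one.2 hs1), one_mul]
  eq_zero s hs := by
    rw [hφ.2.2.2 _ (Real.le_sqrt_of_sq_le (by linarith)), zero_mul]

/-- The profile of the Adams function, up to normalization, in the variable `s = ‖x‖²`. -/
def adamsProfile (Φ : ℝ → ℝ) (N s : ℝ) : ℝ :=
  if s ≤ (N ^ 2)⁻¹ then Real.log N + (1 - N ^ 2 * s) / 2 else -Φ s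

/-- The derivative of `adamsProfile`. -/
def adamsSlope (Φ : ℝ → ℝ) (N s : ℝ) : ℝ := -deriv Φ (max s (N ^ 2)⁻¹)

/-! ### Calculus of the truncated logarithm and the `C^{1,1}` gluing at radius `1/N`. -/

namespace IsLogTruncation

variable {Φ : ℝ → ℝ} {N : ℝ}

lemma hasDerivAt (h : IsLogTruncation Φ) {s : ℝ} (hs : 0 < s) : HasDerivAt Φ (deriv Φ s) s :=
  ((h.contDiffOn.differentiableOn (by simp)).differentiableAt (Ioi_mem_nhds hs)).hasDerivAt

lemma contDiffOn_deriv (h : IsLogTruncation Φ) : ContDiffOn ℝ ∞ (deriv Φ) (Ioi 0) :=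
  h.contDiffOn.deriv_of_isOpen isOpen_Ioi (by simp)

lemma hasDerivAt_deriv (h : IsLogTruncation Φ) {s : ℝ} (hs : 0 < s) :
    HasDerivAt (deriv Φ) (deriv (deriv Φ) s) s :=
  ((h.contDiffOn_deriv.differentiableOn (by simp)).differentiableAt
    (Ioi_mem_nhds hs)).hasDerivAt

lemma continuousOn_deriv_deriv (h : IsLogTruncation Φ) :
    ContinuousOn (deriv (deriv Φ)) (Ioi 0) :=
  (h.contDiffOn_deriv.deriv_of_isOpen (m := ∞) isOpen_Ioi (by simp)).continuousOn

lemma deriv_eq (h : IsLogTruncation Φ) {s : ℝ} (hs : 0 < s) (hs1 : s < 1) :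
    deriv Φ s = 1 / (2 * s) := by
  have he : Φ =ᶠ[𝓝 s] fun s => Real.log s / 2 := by
    filter_upwards [Ioo_mem_nhds hs hs1] with r hr
    exact h.eq_log r hr.1 hr.2.le
  rw [he.deriv_eq, deriv_div_const, Real.deriv_log]
  field_simp

lemma deriv_deriv_eq (h : IsLogTruncation Φ) {s : ℝ} (hs : 0 < s) (hs1 : s < 1) :
    deriv (deriv Φ) s = -1 / (2 * s ^ 2) := by
  have he : deriv Φ =ᶠ[𝓝 s] fun s => s⁻¹ / 2 := by
    filter_upwards [Ioo_mem_nhds hs hs1] with r hr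
    rw [h.deriv_eq hr.1 hr.2]
    field_simp
  rw [he.deriv_eq, deriv_div_const, deriv_inv]
  field_simp

lemma deriv_eq_zero_of_lt (h : IsLogTruncation Φ) {s : ℝ} (hs : 4 < s) : deriv Φ s = 0 := by
  have he : Φ =ᶠ[𝓝 s] fun _ => 0 := by
    filter_upwards [Ioi_mem_nhds hs] with r hr
    exact h.eq_zero r (le_of_lt hr)
  rw [he.deriv_eq, deriv_const]

lemma deriv_deriv_eq_zero_of_lt (h : IsLogTruncation Φ) {s : ℝ} (hs : 4 < s) :
    deriv (deriv Φ) s = 0 := by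
  have he : deriv Φ =ᶠ[𝓝 s] fun _ => 0 := by
    filter_upwards [Ioi_mem_nhds hs] with r hr
    exact h.deriv_eq_zero_of_lt hr
  rw [he.deriv_eq, deriv_const]

/-- Local constancy kills the derivatives of `Φ` only for `s > 4`; continuity supplies the endpoint.
-/
lemma eq_zero_of_continuousAt {f : ℝ → ℝ} (hf : ContinuousAt f 4) (h0 : ∀ s, 4 < s → f s = 0)
    {s : ℝ} (hs : 4 ≤ s) : f s = 0 := by
  rcases hs.eq_or_lt with rfl | hs
  · have h1 : Tendsto f (𝓝[>] 4) (𝓝 (f 4)) := hf.mono_left nhdsWithin_le_nhds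
    have h2 : Tendsto f (𝓝[>] 4) (𝓝 0) := by
      refine tendsto_const_nhds.congr' ?_
      filter_upwards [self_mem_nhdsWithin] with r hr
      exact (h0 r hr).symm
    exact tendsto_nhds_unique h1 h2
  · exact h0 s hs

lemma deriv_eq_zero (h : IsLogTruncation Φ) {s : ℝ} (hs : 4 ≤ s) : deriv Φ s = 0 :=
  eq_zero_of_continuousAt (h.hasDerivAt_deriv (by norm_num)).continuousAt
    (fun _ => h.deriv_eq_zero_of_lt) hs

lemma deriv_deriv_eq_zero (h : IsLogTruncation Φ) {s : ℝ} (hs : 4 ≤ s) :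
    deriv (deriv Φ) s = 0 :=
  eq_zero_of_continuousAt (h.continuousOn_deriv_deriv.continuousAt (Ioi_mem_nhds (by norm_num)))
    (fun _ => h.deriv_deriv_eq_zero_of_lt) hs

/-- The slope is `-deriv Φ` composed with `max · (N ^ 2)⁻¹`, which avoids the singularity at zero.
The second derivative is bounded on `[(N ^ 2)⁻¹, 4]` by compactness and vanishes beyond. -/
lemma exists_lipschitzWith_adamsSlope (h : IsLogTruncation Φ) (hN : 0 < N) :
    ∃ K, LipschitzWith K (adamsSlope Φ N) := by
  have hδ : 0 < (N ^ 2)⁻¹ := by positivity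
  obtain ⟨C, hC⟩ := (isCompact_Icc (a := (N ^ 2)⁻¹) (b := 4)).exists_bound_of_continuousOn
    (h.continuousOn_deriv_deriv.mono fun s hs => hδ.trans_le hs.1)
  have h1 : LipschitzOnWith (Real.toNNReal C) (deriv Φ) (Ici (N ^ 2)⁻¹) := by
    refine Convex.lipschitzOnWith_of_nnnorm_deriv_le
      (fun s hs => (h.hasDerivAt_deriv (hδ.trans_le hs)).differentiableAt) (fun s hs => ?_)
      (convex_Ici _)
    rw [← NNReal.coe_le_coe, coe_nnnorm, Real.coe_toNNReal']
    rcases le_total s 4 with h4 | h4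
    · exact (hC s ⟨hs, h4⟩).trans (le_max_left _ _)
    · rw [h.deriv_deriv_eq_zero h4, norm_zero]
      exact le_max_right _ _
  have h2 : LipschitzWith 1 fun s : ℝ => max s (N ^ 2)⁻¹ := LipschitzWith.id.max_const _
  have h3 : LipschitzOnWith _ (deriv Φ ∘ fun s : ℝ => max s (N ^ 2)⁻¹) univ :=
    h1.comp h2.lipschitzOnWith fun s _ => mem_Ici.2 (le_max_right _ _)
  exact ⟨_, (lipschitzOnWith_univ.1 h3).neg⟩

lemma inv_sq_lt_one (hN : 1 < N) : (N ^ 2)⁻¹ < 1 :=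
  inv_lt_one_of_one_lt₀ (one_lt_pow₀ hN two_ne_zero)

lemma adamsSlope_of_le (h : IsLogTruncation Φ) (hN : 1 < N) {s : ℝ} (hs : s ≤ (N ^ 2)⁻¹) :
    adamsSlope Φ N s = -(N ^ 2 / 2) := by
  have hN0 : 0 < N := one_pos.trans hN
  rw [adamsSlope, max_eq_right hs, h.deriv_eq (by positivity) (inv_sq_lt_one hN)]
  field_simp

lemma adamsSlope_of_ge {s : ℝ} (hs : (N ^ 2)⁻¹ ≤ s) :
    adamsSlope Φ N s = -deriv Φ s := by
  rw [adamsSlope, max_eq_left hs]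

lemma adamsProfile_of_ge (h : IsLogTruncation Φ) (hN : 1 < N) {s : ℝ} (hs : (N ^ 2)⁻¹ ≤ s) :
    adamsProfile Φ N s = -Φ s := by
  have hN0 : 0 < N := one_pos.trans hN
  rcases hs.eq_or_lt with rfl | hs
  · rw [adamsProfile, if_pos le_rfl, h.eq_log _ (by positivity) (inv_sq_lt_one hN).le,
      Real.log_inv, Real.log_pow]
    field_simp
    push_cast
    ring
  · rw [adamsProfile, if_neg hs.not_ge]

lemma adamsProfile_of_le {s : ℝ} (hs : s ≤ (N ^ 2)⁻¹) :
    adamsProfile Φ N s = Real.log N + (1 - N ^ 2 * s) / 2 := by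
  rw [adamsProfile, if_pos hs]

/-- The affine cap and `-Φ` have the same value `log N` and the same slope `-N²/2` at `s = N⁻²`, so
the one-sided derivatives glue. -/
lemma hasDerivAt_adamsProfile (h : IsLogTruncation Φ) (hN : 1 < N) (s : ℝ) :
    HasDerivAt (adamsProfile Φ N) (adamsSlope Φ N s) s := by
  have hN0 : 0 < N := one_pos.trans hN
  have hin : ∀ s, HasDerivAt (fun s => Real.log N + (1 - N ^ 2 * s) / 2) (-(N ^ 2 / 2)) s := by
    intro s
    exact (((((hasDerivAt_id' s).const_mul (N ^ 2)).const_sub 1).div_const 2).const_add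
      (Real.log N)).congr_deriv (by ring)
  have hl : s ≤ (N ^ 2)⁻¹ →
      HasDerivWithinAt (adamsProfile Φ N) (adamsSlope Φ N s) (Iic (N ^ 2)⁻¹) s := by
    intro hs
    rw [h.adamsSlope_of_le hN hs]
    exact (hin s).hasDerivWithinAt.congr (fun r hr => adamsProfile_of_le hr)
      (adamsProfile_of_le hs)
  have hr : (N ^ 2)⁻¹ ≤ s →
      HasDerivWithinAt (adamsProfile Φ N) (adamsSlope Φ N s) (Ici (N ^ 2)⁻¹) s := by
    intro hs
    rw [adamsSlope_of_ge hs]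
    have hs0 : 0 < s := lt_of_lt_of_le (by positivity) hs
    exact (h.hasDerivAt hs0).neg.hasDerivWithinAt.congr
      (fun r hr => h.adamsProfile_of_ge hN hr) (h.adamsProfile_of_ge hN hs)
  rcases lt_trichotomy s (N ^ 2)⁻¹ with hs | hs | hs
  · exact (hl hs.le).hasDerivAt (Iic_mem_nhds hs)
  · have := (hl hs.le).union (hr hs.ge)
    rwa [Iic_union_Ici, hasDerivWithinAt_univ] at this
  · exact (hr hs.le).hasDerivAt (Ici_mem_nhds hs)

lemma adamsProfile_eq_zero (h : IsLogTruncation Φ) (hN : 1 < N) {s : ℝ} (hs : 4 ≤ s) :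
    adamsProfile Φ N s = 0 := by
  have := inv_sq_lt_one hN
  rw [h.adamsProfile_of_ge hN (by linarith), h.eq_zero s hs, neg_zero]

lemma adamsSlope_eq_zero (h : IsLogTruncation Φ) (hN : 1 < N) {s : ℝ} (hs : 4 ≤ s) :
    adamsSlope Φ N s = 0 := by
  have := inv_sq_lt_one hN
  rw [adamsSlope_of_ge (by linarith), h.deriv_eq_zero hs, neg_zero]

end IsLogTruncation

/-- The Adams function, up to normalization. -/
def adamsRaw (Φ : ℝ → ℝ) (N : ℝ) (x : R4) : ℝ := adamsProfile Φ N (‖x‖ ^ 2)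

lemma IsLogTruncation.hasLipschitzGradient_adamsRaw {Φ : ℝ → ℝ} (h : IsLogTruncation Φ) {N : ℝ}
    (hN : 1 < N) : HasLipschitzGradient (adamsRaw Φ N) (radialGrad (adamsSlope Φ N)) := by
  obtain ⟨K, hK⟩ := h.exists_lipschitzWith_adamsSlope (one_pos.trans hN)
  exact hasLipschitzGradient_radial (h.hasDerivAt_adamsProfile hN)
    (fun s hs => h.adamsProfile_eq_zero hN hs) hK (fun s hs => h.adamsSlope_eq_zero hN hs)

/-- The Laplacian of the tail of the Adams function, as a function of `r = ‖x‖`. -/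
def tailLaplacian (Φ : ℝ → ℝ) (r : ℝ) : ℝ :=
  8 * deriv Φ (r ^ 2) + 4 * r ^ 2 * deriv (deriv Φ) (r ^ 2)

lemma IsLogTruncation.lineDivergence_adams {Φ : ℝ → ℝ} (h : IsLogTruncation Φ) {N : ℝ}
    (hN : 1 < N) {x : R4} (hx : ‖x‖ ≠ N⁻¹) :
    lineDivergence (radialGrad (adamsSlope Φ N)) x =
      if ‖x‖ ≤ N⁻¹ then -(4 * N ^ 2) else -tailLaplacian Φ ‖x‖ := by
  have hN0 : 0 < N := one_pos.trans hN
  rcases lt_or_gt_of_ne hx with hx | hx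
  · have hs : ‖x‖ ^ 2 < (N ^ 2)⁻¹ := by
      rw [← inv_pow]
      exact pow_lt_pow_left₀ hx (norm_nonneg _) two_ne_zero
    have he : adamsSlope Φ N =ᶠ[𝓝 (‖x‖ ^ 2)] fun _ => -(N ^ 2 / 2) := by
      filter_upwards [Iio_mem_nhds hs] with r hr
      exact h.adamsSlope_of_le hN (le_of_lt hr)
    rw [lineDivergence_radialGrad ((hasDerivAt_const _ _).congr_of_eventuallyEq he), if_pos hx.le,
      h.adamsSlope_of_le hN hs.le]
    ring
  · have hs : (N ^ 2)⁻¹ < ‖x‖ ^ 2 := by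
      rw [← inv_pow]
      exact pow_lt_pow_left₀ hx (by positivity) two_ne_zero
    have he : adamsSlope Φ N =ᶠ[𝓝 (‖x‖ ^ 2)] fun s => -deriv Φ s := by
      filter_upwards [Ioi_mem_nhds hs] with r hr
      exact adamsSlope_of_ge (le_of_lt hr)
    have hs0 : 0 < ‖x‖ ^ 2 := lt_trans (by positivity) hs
    rw [lineDivergence_radialGrad ((h.hasDerivAt_deriv hs0).neg.congr_of_eventuallyEq he),
      if_neg hx.not_ge, adamsSlope_of_ge hs.le, tailLaplacian]
    ring

/-! ### The exact Laplacian energy in polar coordinates. -/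

lemma volume_real_ball_R4 : volume.real (Metric.ball (0 : R4) 1) = Real.pi ^ 2 / 2 := by
  rw [Measure.real, EuclideanSpace.volume_ball]
  have h1 : Real.Gamma ((Fintype.card (Fin 4) : ℝ) / 2 + 1) = 2 := by
    have := Real.Gamma_nat_eq_factorial 2
    norm_num at this ⊢
  have h2 : √Real.pi ^ 4 = Real.pi ^ 2 := by
    rw [show (4 : ℕ) = 2 * 2 by norm_num, pow_mul, Real.sq_sqrt Real.pi_pos.le]
  rw [h1, Fintype.card_fin, h2]
  simp
  positivity

lemma integral_radial (f : ℝ → ℝ) :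
    ∫ x : R4, f ‖x‖ = 2 * Real.pi ^ 2 * ∫ r in Ioi (0 : ℝ), r ^ 3 * f r := by
  rw [integral_fun_norm_addHaar, finrank_euclideanSpace_fin, volume_real_ball_R4]
  simp only [smul_eq_mul, nsmul_eq_mul]
  push_cast
  ring

/-- The Laplacian energy of the tail of the Adams function outside the unit ball. -/
def tailEnergy (Φ : ℝ → ℝ) : ℝ := ∫ r in Ioi (1 : ℝ), r ^ 3 * tailLaplacian Φ r ^ 2

lemma tailEnergy_nonneg (Φ : ℝ → ℝ) : 0 ≤ tailEnergy Φ :=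
  setIntegral_nonneg measurableSet_Ioi fun r hr => by
    have : (0 : ℝ) < r := one_pos.trans hr
    positivity

lemma IsLogTruncation.integrableOn_tail {Φ : ℝ → ℝ} (h : IsLogTruncation Φ) :
    IntegrableOn (fun r => r ^ 3 * tailLaplacian Φ r ^ 2) (Ioi 1) := by
  have hc : ContinuousOn (fun r => r ^ 3 * tailLaplacian Φ r ^ 2) (Icc 1 2) := by
    have hm : MapsTo (fun r : ℝ => r ^ 2) (Icc 1 2) (Ioi 0) := fun r hr => by
      have : (0 : ℝ) < r := one_pos.trans_le hr.1
      exact pow_pos this 2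
    have c1 : ContinuousOn (fun r : ℝ => deriv Φ (r ^ 2)) (Icc 1 2) :=
      h.contDiffOn_deriv.continuousOn.comp (by fun_prop) hm
    have c2 : ContinuousOn (fun r : ℝ => deriv (deriv Φ) (r ^ 2)) (Icc 1 2) :=
      h.continuousOn_deriv_deriv.comp (by fun_prop) hm
    unfold tailLaplacian
    fun_prop
  have h1 : IntegrableOn (fun r => r ^ 3 * tailLaplacian Φ r ^ 2) (Ioc 1 2) :=
    (hc.integrableOn_compact isCompact_Icc).mono_set Ioc_subset_Icc_self
  have h2 : IntegrableOn (fun r => r ^ 3 * tailLaplacian Φ r ^ 2) (Ioi 2) := by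
    refine (integrableOn_zero (ε' := ℝ)).congr_fun (fun r hr => ?_) measurableSet_Ioi
    have hr4 : (4 : ℝ) ≤ r ^ 2 := by nlinarith [mem_Ioi.1 hr]
    simp [tailLaplacian, h.deriv_eq_zero hr4, h.deriv_deriv_eq_zero hr4]
  rw [← Ioc_union_Ioi_eq_Ioi one_le_two]
  exact h1.union h2

/-- The Laplacian is `-4N²` on the cap, giving `4`; it is `-2/r²` on the annulus up to radius one,
giving `∫ 4/r = 4 log N`; the tail does not depend on `N`. -/
lemma IsLogTruncation.integral_lineDivergence_sq {Φ : ℝ → ℝ} (h : IsLogTruncation Φ) {N : ℝ}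
    (hN : 1 < N) : ∫ x, lineDivergence (radialGrad (adamsSlope Φ N)) x ^ 2 =
      2 * Real.pi ^ 2 * (4 + 4 * Real.log N + tailEnergy Φ) := by
  have hN0 : 0 < N := one_pos.trans hN
  have hNi : 0 < N⁻¹ := inv_pos.2 hN0
  have hNi1 : N⁻¹ < 1 := inv_lt_one_of_one_lt₀ hN
  set f : ℝ → ℝ := fun r => if r ≤ N⁻¹ then (4 * N ^ 2) ^ 2 else tailLaplacian Φ r ^ 2 with hf
  have hae : (fun x : R4 => lineDivergence (radialGrad (adamsSlope Φ N)) x ^ 2)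
      =ᵐ[volume] fun x => f ‖x‖ := by
    have hsph : ∀ᵐ x : R4, x ∉ Metric.sphere (0 : R4) N⁻¹ :=
      measure_eq_zero_iff_ae_notMem.1 (Measure.addHaar_sphere _ _ _)
    filter_upwards [hsph] with x hx
    rw [mem_sphere_zero_iff_norm] at hx
    rw [h.lineDivergence_adams hN hx, hf]
    simp only
    split_ifs <;> ring
  rw [integral_congr_ae hae, integral_radial]
  congr 1
  have e1 : EqOn (fun r => r ^ 3 * f r) (fun r => (4 * N ^ 2) ^ 2 * r ^ 3) (Ioc 0 N⁻¹) := by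
    intro r hr
    simp only [hf, if_pos hr.2]
    ring
  have e2 : EqOn (fun r => r ^ 3 * f r) (fun r => 4 * r⁻¹) (Ioo N⁻¹ 1) := by
    intro r hr
    have hr0 : 0 < r := hNi.trans hr.1
    have hr2 : 0 < r ^ 2 := by positivity
    have hr21 : r ^ 2 < 1 := by nlinarith [hr.2]
    simp only [hf, if_neg hr.1.not_ge, tailLaplacian, h.deriv_eq hr2 hr21,
      h.deriv_deriv_eq hr2 hr21]
    field_simp
    ring
  have e3 : EqOn (fun r => r ^ 3 * f r) (fun r => r ^ 3 * tailLaplacian Φ r ^ 2) (Ioi 1) := by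
    intro r hr
    simp only [hf, if_neg (hNi1.trans hr).not_ge]
  have i1 : IntegrableOn (fun r => r ^ 3 * f r) (Ioc 0 N⁻¹) :=
    IntegrableOn.congr_fun (((Continuous.integrableOn_Icc (by fun_prop)).mono_set
      Ioc_subset_Icc_self)) e1.symm measurableSet_Ioc
  have i2' : IntegrableOn (fun r : ℝ => 4 * r⁻¹) (Ioo N⁻¹ 1) := by
    have : ContinuousOn (fun r : ℝ => 4 * r⁻¹) (Icc N⁻¹ 1) :=
      continuousOn_const.mul (continuousOn_inv₀.mono fun r hr => (hNi.trans_le hr.1).ne')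
    exact (this.integrableOn_compact isCompact_Icc).mono_set Ioo_subset_Icc_self
  have i2 : IntegrableOn (fun r => r ^ 3 * f r) (Ioc N⁻¹ 1) :=
    (integrableOn_Ioc_iff_integrableOn_Ioo).2 (i2'.congr_fun e2.symm measurableSet_Ioo)
  have i3 : IntegrableOn (fun r => r ^ 3 * f r) (Ioi 1) :=
    h.integrableOn_tail.congr_fun e3.symm measurableSet_Ioi
  have i23 : IntegrableOn (fun r => r ^ 3 * f r) (Ioi N⁻¹) := by
    rw [← Ioc_union_Ioi_eq_Ioi hNi1.le]
    exact i2.union i3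
  rw [← Ioc_union_Ioi_eq_Ioi hNi.le, setIntegral_union Ioc_disjoint_Ioi_same measurableSet_Ioi
    i1 i23, ← Ioc_union_Ioi_eq_Ioi hNi1.le, setIntegral_union Ioc_disjoint_Ioi_same
    measurableSet_Ioi i2 i3, integral_Ioc_eq_integral_Ioo (x := N⁻¹),
    setIntegral_congr_fun measurableSet_Ioc e1, setIntegral_congr_fun measurableSet_Ioo e2,
    setIntegral_congr_fun measurableSet_Ioi e3, ← integral_Ioc_eq_integral_Ioo,
    ← intervalIntegral.integral_of_le hNi.le, ← intervalIntegral.integral_of_le hNi1.le,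
    intervalIntegral.integral_const_mul, intervalIntegral.integral_const_mul, integral_pow,
    integral_inv_of_pos hNi one_pos, ← tailEnergy, one_div, inv_inv]
  have hNN : N * N⁻¹ = 1 := mul_inv_cancel₀ hN0.ne'
  have hN4 : N ^ 4 * N⁻¹ ^ 4 = 1 := by rw [← mul_pow, hNN, one_pow]
  norm_num
  linear_combination 4 * hN4

/-! ### The mass of the Adams functions -/

lemma adams_eq_mul_adamsRaw (φ : ℝ → ℝ) (hφ : IsCutoff φ) {n : ℕ} (hn : 2 ≤ n) (x : R4) :
    adams φ n x = (√(8 * Real.pi ^ 2 * Real.log n))⁻¹ *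
      adamsRaw (fun s => φ (√s) * (Real.log s / 2)) n x := by
  have hn1 : (1 : ℝ) < n := by exact_mod_cast hn
  have hn0 : (0 : ℝ) < n := one_pos.trans hn1
  have hl : 0 < Real.log n := Real.log_pos hn1
  set S := √(8 * Real.pi ^ 2 * Real.log n) with hS
  have hS0 : 0 < S := Real.sqrt_pos.2 (by positivity)
  have hSS : S ^ 2 = 8 * Real.pi ^ 2 * Real.log n := Real.sq_sqrt (by positivity)
  have h1 : √(Real.log n / (8 * Real.pi ^ 2)) = S⁻¹ * Real.log n := by
    rw [Real.sqrt_eq_iff_eq_sq (by positivity) (by positivity), mul_pow, inv_pow, hSS]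
    field_simp
  have h2 : √(32 * Real.pi ^ 2 * Real.log n) = 2 * S := by
    rw [Real.sqrt_eq_iff_eq_sq (by positivity) (by positivity), mul_pow, hSS]
    ring
  have hle : ‖x‖ ≤ 1 / (n : ℝ) ↔ ‖x‖ ^ 2 ≤ ((n : ℝ) ^ 2)⁻¹ := by
    rw [one_div, ← inv_pow, sq_le_sq₀ (norm_nonneg x) (by positivity)]
  have hlog : Real.log (‖x‖ ^ 2) = 2 * Real.log ‖x‖ := by
    rw [Real.log_pow]
    norm_num
  rw [adams, adamsRaw, adamsProfile]
  by_cases hx : ‖x‖ ≤ 1 / (n : ℝ)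
  · rw [if_pos hx, if_pos (hle.1 hx), h1, h2]
    field_simp
  · rw [if_neg hx, if_neg (hle.not.1 hx), Real.sqrt_sq (norm_nonneg x), hlog]
    split_ifs with h3 h4
    · rw [hφ.2.2.1 _ (norm_nonneg x) h3, ← hS]
      field_simp
    · rw [← hS]
      field_simp
    · rw [hφ.2.2.2 _ (not_lt.1 h4)]
      simp

/-- The squared `L²` norm of `adamsRaw`. -/
def adamsRawMass (Φ : ℝ → ℝ) (N : ℝ) : ℝ := ∫ x, adamsRaw Φ N x ^ 2

/-- The factor `√(8π² log n)` cancels under mass normalization, so only the raw profile matters from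
here on. -/
lemma adamsMass_eq (φ : ℝ → ℝ) (hφ : IsCutoff φ) {n : ℕ} (hn : 2 ≤ n) (c : ℝ) (x : R4) :
    adamsMass φ c n x = c / √(adamsRawMass (fun s => φ (√s) * (Real.log s / 2)) n) *
      adamsRaw (fun s => φ (√s) * (Real.log s / 2)) n x := by
  have hn1 : (1 : ℝ) < n := by exact_mod_cast hn
  have hl : 0 < Real.log n := Real.log_pos hn1
  have hS0 : 0 < √(8 * Real.pi ^ 2 * Real.log n) := Real.sqrt_pos.2 (by positivity)
  rw [adamsMass]
  simp only [adams_eq_mul_adamsRaw φ hφ hn, mul_pow]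
  generalize √(8 * Real.pi ^ 2 * Real.log n) = S at hS0 ⊢
  rw [integral_const_mul, ← adamsRawMass, Real.sqrt_mul (by positivity),
    Real.sqrt_sq (by positivity)]
  field_simp

namespace IsLogTruncation

variable {Φ : ℝ → ℝ} {N : ℝ}

lemma adamsRaw_of_norm_le {x : R4} (hx : ‖x‖ ≤ N⁻¹) :
    adamsRaw Φ N x = Real.log N + (1 - N ^ 2 * ‖x‖ ^ 2) / 2 := by
  refine adamsProfile_of_le ?_
  rw [← inv_pow]
  exact pow_le_pow_left₀ (norm_nonneg x) hx 2

lemma log_le_adamsRaw {x : R4} (hN : 0 < N) (hx : ‖x‖ ≤ N⁻¹) : Real.log N ≤ adamsRaw Φ N x := by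
  rw [adamsRaw_of_norm_le hx]
  have h1 : N * ‖x‖ ≤ 1 := by
    rw [← mul_inv_cancel₀ hN.ne']
    gcongr
  have h2 : (N * ‖x‖) ^ 2 ≤ 1 := pow_le_one₀ (by positivity) h1
  rw [mul_pow] at h2
  linarith

lemma adamsRawMass_pos (h : IsLogTruncation Φ) (hN : 1 < N) : 0 < adamsRawMass Φ N := by
  have hg := h.hasLipschitzGradient_adamsRaw hN
  have h0 : adamsRaw Φ N 0 ≠ 0 := by
    have h1 : Real.log N ≤ adamsRaw Φ N 0 :=
      log_le_adamsRaw (one_pos.trans hN) (by rw [norm_zero]; positivity)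
    exact ((Real.log_pos hN).trans_le h1).ne'
  have hc : Continuous fun x => adamsRaw Φ N x ^ 2 := hg.continuous.pow 2
  have hs : HasCompactSupport fun x => adamsRaw Φ N x ^ 2 :=
    hg.hasCompactSupport.comp_left (g := fun r : ℝ => r ^ 2) (by simp)
  exact hc.integral_pos_of_hasCompactSupport_nonneg_nonzero hs (fun x => sq_nonneg _)
    (x := 0) (pow_ne_zero 2 h0)

/-- The mass of `adamsRaw` is bounded independently of the concentration parameter. -/
lemma exists_adamsRawMass_le (h : IsLogTruncation Φ) :
    ∃ C : ℝ, 0 < C ∧ ∀ N : ℝ, 1 < N → adamsRawMass Φ N ≤ C := by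
  obtain ⟨M, hM⟩ := (isCompact_Icc (a := (1 : ℝ)) (b := 4)).exists_bound_of_continuousOn
    (h.contDiffOn.continuousOn.mono fun s hs => one_pos.trans_le hs.1)
  -- Inside the unit ball `|adamsRaw| ≤ ‖x‖⁻¹`, from `log r ≤ r - 1`, and `‖x‖⁻²` is locally
  -- integrable in dimension four; `M` bounds `Φ` on the transition zone.
  set f : R4 → ℝ := (Metric.closedBall 0 2).indicator fun x => ‖x‖ ^ (-2 : ℝ) + M ^ 2
  have hfi : Integrable f volume := by
    refine (integrable_indicator_iff Metric.isClosed_closedBall.measurableSet).2 ?_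
    exact ((locallyIntegrable_norm_rpow (by norm_num)).integrableOn_isCompact
      (isCompact_closedBall _ _)).add
      (integrableOn_const (isCompact_closedBall _ _).measure_lt_top.ne)
  have key : ∀ N : ℝ, 1 < N → adamsRawMass Φ N ≤ ∫ x, f x := by
    intro N hN
    have hN0 : 0 < N := one_pos.trans hN
    have hg := h.hasLipschitzGradient_adamsRaw hN
    refine integral_mono_ae (hg.continuous.memLp_of_hasCompactSupport
      hg.hasCompactSupport).integrable_sq hfi ?_
    have hne : ∀ᵐ x : R4, x ≠ 0 := by simp [ae_iff]
    filter_upwards [hne] with x hx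
    have hx0 : 0 < ‖x‖ := norm_pos_iff.2 hx
    have hrp : ‖x‖ ^ (-2 : ℝ) = (‖x‖⁻¹) ^ 2 := by
      rw [Real.rpow_neg hx0.le, inv_pow]
      norm_num
    have hlog : Real.log (‖x‖⁻¹) ≤ ‖x‖⁻¹ - 1 := Real.log_le_sub_one_of_pos (by positivity)
    rcases le_or_gt ‖x‖ 2 with h2 | h2
    · have hf : f x = (‖x‖⁻¹) ^ 2 + M ^ 2 := by
        simp only [f]
        rw [indicator_of_mem (mem_closedBall_zero_iff.2 h2), hrp]
      rw [hf]
      rcases le_or_gt ‖x‖ 1 with h1 | h1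
      · have hb : |adamsRaw Φ N x| ≤ ‖x‖⁻¹ := by
          rcases le_total ‖x‖ N⁻¹ with hxN | hxN
          · have hp := (Real.log_pos hN).le.trans (log_le_adamsRaw (Φ := Φ) hN0 hxN)
            rw [abs_of_nonneg hp, adamsRaw_of_norm_le hxN]
            have h3 : Real.log N ≤ Real.log (‖x‖⁻¹) :=
              Real.log_le_log hN0 ((le_inv_comm₀ hx0 hN0).1 hxN)
            have h4 : 0 ≤ N ^ 2 * ‖x‖ ^ 2 := by positivity
            linarith
          · have hs : (N ^ 2)⁻¹ ≤ ‖x‖ ^ 2 := by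
              rw [← inv_pow]
              exact pow_le_pow_left₀ (by positivity) hxN 2
            have h3 : 0 ≤ Real.log (‖x‖⁻¹) := Real.log_nonneg ((one_le_inv₀ hx0).2 h1)
            have h4 : adamsRaw Φ N x = Real.log (‖x‖⁻¹) := by
              rw [adamsRaw, h.adamsProfile_of_ge hN hs,
                h.eq_log _ (by positivity) (pow_le_one₀ hx0.le h1), Real.log_pow, Real.log_inv]
              push_cast
              ring
            rw [h4, abs_of_nonneg h3]
            linarith
        have := sq_le_sq' (neg_le_of_abs_le hb) (le_of_abs_le hb)
        nlinarith [sq_nonneg M]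
      · have h3 := inv_sq_lt_one hN
        have h4 : 1 ≤ ‖x‖ ^ 2 := one_le_pow₀ h1.le
        have h5 := hM (‖x‖ ^ 2) ⟨h4, by nlinarith⟩
        rw [adamsRaw, h.adamsProfile_of_ge hN (by linarith), neg_sq]
        rw [Real.norm_eq_abs] at h5
        have := sq_le_sq' (neg_le_of_abs_le h5) (le_of_abs_le h5)
        nlinarith [sq_nonneg (‖x‖⁻¹)]
    · have h3 : adamsRaw Φ N x = 0 := h.adamsProfile_eq_zero hN (by nlinarith)
      rw [h3]
      refine (by norm_num : (0 : ℝ) ^ 2 ≤ 0).trans (indicator_nonneg (fun y _ => ?_) x)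
      positivity
  exact ⟨∫ x, f x, (h.adamsRawMass_pos one_lt_two).trans_le (key 2 one_lt_two), key⟩

end IsLogTruncation

/-! ### The functionals along the fibering map -/

section

variable {U : R4 → ℝ} {g : Fin 4 → R4 → ℝ} {F : ℝ × ℝ → ℝ} {A B t μ : ℝ}

lemma HasLipschitzGradient.laplaceEnergy_fiber (h : HasLipschitzGradient U g) (ht : 0 < t) :
    laplaceEnergy (fun x => t * A * U (√t • x)) (fun x => t * B * U (√t • x)) =
      t ^ 2 * ((A ^ 2 + B ^ 2) * ∫ x, lineDivergence g x ^ 2) := by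
  have hs : 0 < √t := Real.sqrt_pos.2 ht
  rw [(h.const_mul_comp_smul (t * A) hs.ne').laplaceEnergy_eq
    (h.const_mul_comp_smul (t * B) hs.ne'), integral_lineDivergence_sq_comp_smul _ _ hs,
    integral_lineDivergence_sq_comp_smul _ _ hs]
  ring

lemma sqrt_rpow_eq (ht : 0 < t) : √t ^ (μ - 8) = t ^ (μ / 2 - 4) := by
  rw [Real.sqrt_eq_rpow, ← Real.rpow_mul ht.le]
  congr 1
  ring

/-- The pair of multiples of `U` as a map into `ℝ × ℝ`. -/
def pairMap (A B : ℝ) (U : R4 → ℝ) (x : R4) : ℝ × ℝ := (A * U x, B * U x)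

lemma HasLipschitzGradient.continuous_pairMap (h : HasLipschitzGradient U g) :
    Continuous (pairMap A B U) :=
  (continuous_const.mul h.continuous).prodMk (continuous_const.mul h.continuous)

lemma HasLipschitzGradient.hasCompactSupport_pairMap (h : HasLipschitzGradient U g) :
    HasCompactSupport (pairMap A B U) :=
  h.hasCompactSupport.comp_left (g := fun r : ℝ => (A * r, B * r)) (by simp)

/-- Scaling by `√t` gives `(√t)^(μ-8) = t^(μ/2-4)`. Separate `G` and `H` serve both the energy (`F`,
`F`) and the Pohozaev functional (`frakF μ F`, `F`). -/
lemma HasLipschitzGradient.integral_rieszConv_fiber (h : HasLipschitzGradient U g) (hμ : μ < 4)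
    (ht : 0 < t) {G H : ℝ × ℝ → ℝ} (hG : Continuous G) (hH : Continuous H) (hG0 : G 0 = 0)
    (hH0 : H 0 = 0) :
    ∫ x, rieszConv μ (fun y => H (t * A * U (√t • y), t * B * U (√t • y))) x *
        G (t * A * U (√t • x), t * B * U (√t • x)) =
      t ^ (μ / 2 - 4) * rieszForm μ (fun x => G (t • pairMap A B U x))
        (fun x => H (t • pairMap A B U x)) := by
  have hs : 0 < √t := Real.sqrt_pos.2 ht
  have hc := h.continuous_pairMap (A := A) (B := B)
  have hcs := h.hasCompactSupport_pairMap (A := A) (B := B)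
  have e : ∀ (G : ℝ × ℝ → ℝ) (x : R4), G (t * A * U (√t • x), t * B * U (√t • x)) =
      (fun x => G (t • pairMap A B U x)) (√t • x) := by
    intro G x
    simp only [pairMap, Prod.smul_mk, smul_eq_mul, mul_assoc]
  simp only [e]
  rw [← sqrt_rpow_eq ht, ← rieszForm_comp_smul hs]
  exact integral_rieszConv_mul hμ ((continuous_comp_smul hG hc t).comp (continuous_const_smul _))
    ((hasCompactSupport_comp_smul hG0 hcs t).comp_smul hs.ne')
    ((continuous_comp_smul hH hc t).comp (continuous_const_smul _))
    ((hasCompactSupport_comp_smul hH0 hcs t).comp_smul hs.ne')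

lemma HasLipschitzGradient.energyJ_fiber (h : HasLipschitzGradient U g) (hμ : μ < 4)
    (ht : 0 < t) (hF : Continuous F) (hF0 : F 0 = 0) :
    energyJ μ F (fun x => t * A * U (√t • x)) (fun x => t * B * U (√t • x)) =
      1 / 2 * (t ^ 2 * ((A ^ 2 + B ^ 2) * ∫ x, lineDivergence g x ^ 2)) -
      1 / 2 * (t ^ (μ / 2 - 4) * rieszForm μ (fun x => F (t • pairMap A B U x))
        (fun x => F (t • pairMap A B U x))) := by
  rw [energyJ, h.laplaceEnergy_fiber ht, h.integral_rieszConv_fiber hμ ht hF hF hF0 hF0]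

lemma HasLipschitzGradient.pohozaevP_fiber (h : HasLipschitzGradient U g) (hμ : μ < 4)
    (ht : 0 < t) (hF : ContDiff ℝ 1 F) (hF0 : F 0 = 0) :
    pohozaevP μ F (fun x => t * A * U (√t • x)) (fun x => t * B * U (√t • x)) =
      t ^ 2 * ((A ^ 2 + B ^ 2) * ∫ x, lineDivergence g x ^ 2) -
      t ^ (μ / 2 - 4) * rieszForm μ (fun x => frakF μ F (t • pairMap A B U x))
        (fun x => F (t • pairMap A B U x)) := by
  rw [pohozaevP, h.laplaceEnergy_fiber ht, h.integral_rieszConv_fiber hμ ht (continuous_frakF hF μ)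
    hF.continuous (by simp [frakF, zGradF_zero, hF0]) hF0]

lemma integral_sq_fiber (U : R4 → ℝ) (A : ℝ) (ht : 0 < t) :
    ∫ x, (t * A * U (√t • x)) ^ 2 = A ^ 2 * ∫ x, U x ^ 2 := by
  have h4 : √t ^ 4 = t ^ 2 := by
    rw [show (4 : ℕ) = 2 * 2 by norm_num, pow_mul, Real.sq_sqrt ht.le]
  simp only [mul_pow]
  rw [integral_const_mul, Measure.integral_comp_smul volume (fun x => U x ^ 2),
    finrank_euclideanSpace_fin, h4, smul_eq_mul, abs_of_pos (by positivity)]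
  field_simp

lemma HasLipschitzGradient.mem_massS (h : HasLipschitzGradient U g) (ht : 0 < t) {a b : ℝ}
    (hA : A ^ 2 * ∫ x, U x ^ 2 = a ^ 2) (hB : B ^ 2 * ∫ x, U x ^ 2 = b ^ 2) :
    ((fun x => t * A * U (√t • x)), (fun x => t * B * U (√t • x))) ∈ massS a b := by
  have hs : √t ≠ 0 := (Real.sqrt_pos.2 ht).ne'
  exact ⟨(h.const_mul_comp_smul _ hs).memH2, (h.const_mul_comp_smul _ hs).memH2,
    (integral_sq_fiber U A ht).trans hA, (integral_sq_fiber U B ht).trans hB⟩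

end

/-! ### Superquadratic maxima and an exponential growth estimate -/

/-- Since `p > 2`, `G` is positive at some small `t₁` and nonpositive for large `t`, so the maximum
over a compact interval is global. -/
lemma exists_isMaxOn_of_superquadratic {G : ℝ → ℝ} {L c p : ℝ} (hG : ContinuousOn G (Ioi 0))
    (hL : 0 < L) (hc : 0 < c) (hp : 2 < p)
    (h1 : ∀ t, 0 < t → t ≤ 1 → L * t ^ 2 - c * t ^ p ≤ G t)
    (h2 : ∀ t, 1 ≤ t → G t ≤ L * t ^ 2 - c * t ^ p) (h3 : ∀ t, 0 < t → G t ≤ L * t ^ 2) :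
    ∃ t, 0 < t ∧ IsMaxOn G (Ioi 0) t := by
  have hp2 : 0 < p - 2 := sub_pos.2 hp
  have hsplit : ∀ t : ℝ, 0 < t → t ^ p = t ^ 2 * t ^ (p - 2) := by
    intro t ht
    rw [← Real.rpow_natCast t 2, ← Real.rpow_add ht]
    congr 1
    push_cast
    ring
  obtain ⟨t₁, ht₁, ht₁1, hv⟩ : ∃ t₁, 0 < t₁ ∧ t₁ ≤ 1 ∧ 0 < G t₁ := by
    have ht : Tendsto (fun t : ℝ => c * t ^ (p - 2)) (𝓝[>] 0) (𝓝 0) := by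
      have : ContinuousAt (fun t : ℝ => c * t ^ (p - 2)) 0 :=
        continuousAt_const.mul (Real.continuousAt_rpow_const 0 _ (Or.inr hp2.le))
      have := this.tendsto.mono_left (nhdsWithin_le_nhds (s := Ioi 0))
      simpa [Real.zero_rpow hp2.ne'] using this
    have hev := (ht.eventually_lt_const hL).and (Ioo_mem_nhdsGT (one_pos (α := ℝ)))
    obtain ⟨t, htL, ht0, ht1⟩ := hev.exists
    refine ⟨t, ht0, ht1.le, lt_of_lt_of_le ?_ (h1 t ht0 ht1.le)⟩
    rw [hsplit t ht0]
    have : 0 < t ^ 2 * (L - c * t ^ (p - 2)) := mul_pos (by positivity) (sub_pos.2 htL)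
    linarith
  obtain ⟨M, hM1, hM⟩ : ∃ M, 1 ≤ M ∧ ∀ t, M ≤ t → G t ≤ 0 := by
    obtain ⟨M, hM⟩ := ((tendsto_rpow_atTop hp2).eventually_ge_atTop (L / c)).exists_forall_of_atTop
    refine ⟨max 1 M, le_max_left _ _, fun t ht => ?_⟩
    have ht1 : 1 ≤ t := (le_max_left _ _).trans ht
    have ht0 : 0 < t := one_pos.trans_le ht1
    have hle := (div_le_iff₀' hc).1 (hM t ((le_max_right _ _).trans ht))
    refine (h2 t ht1).trans ?_
    rw [hsplit t ht0]
    have : 0 ≤ t ^ 2 * (c * t ^ (p - 2) - L) := mul_nonneg (by positivity) (sub_nonneg.2 hle)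
    linarith
  -- Chosen so that `L * s ^ 2 ≤ G t₁` for `0 < s ≤ ε`.
  set ε := min t₁ √(G t₁ / L) with hε
  have hε0 : 0 < ε := lt_min ht₁ (Real.sqrt_pos.2 (div_pos hv hL))
  obtain ⟨t, ht, hmax⟩ := isCompact_Icc.exists_isMaxOn
    (nonempty_Icc.2 ((min_le_left _ _).trans (ht₁1.trans hM1)) : (Icc ε M).Nonempty)
    (hG.mono fun s hs => hε0.trans_le hs.1)
  have hge : G t₁ ≤ G t := hmax ⟨min_le_left _ _, ht₁1.trans hM1⟩
  refine ⟨t, hε0.trans_le ht.1, fun s hs => ?_⟩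
  have hs0 : 0 < s := hs
  rcases le_total s ε with h | h
  · refine ((h3 s hs0).trans ?_).trans hge
    have h5 : s ^ 2 ≤ G t₁ / L := by
      rw [← Real.sq_sqrt (div_pos hv hL).le]
      exact pow_le_pow_left₀ hs0.le (h.trans (min_le_right _ _)) 2
    exact (le_div_iff₀' hL).1 h5
  · rcases le_total s M with h' | h'
    · exact hmax ⟨h, h'⟩
    · exact (hM s h').trans (hv.le.trans hge)

/-- As `q ≤ 2`, `Y^(1+q) ≤ exp(3Y)`. Once `8l ≥ 3 + C`, the quotient of `exp(3Y)` by the exponential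
on the right is at most its value at `y₀`, a constant that `l^q` beats. -/
lemma eventually_lt_rpow_mul_exp {q c C y₀ : ℝ} (hq : 0 < q) (hq2 : q ≤ 2) (hc : 0 < c)
    (hy₀ : 0 < y₀) : ∀ᶠ l : ℝ in atTop, ∀ Y, y₀ ≤ Y →
      Y < c * l ^ q * Y ^ (-q) * Real.exp (8 * l * (Y - y₀) - C * Y) := by
  filter_upwards [(tendsto_rpow_atTop hq).eventually_gt_atTop (Real.exp ((3 + C) * y₀) / c),
    eventually_ge_atTop ((3 + C) / 8)] with l h1 h2 Y hY
  have hY0 : 0 < Y := hy₀.trans_le hY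
  rw [div_lt_iff₀' hc] at h1
  have h3 : Y ^ (1 + q) ≤ Real.exp (3 * Y) := by
    have h4 : Y ≤ Real.exp Y := by linarith [Real.add_one_le_exp Y]
    calc Y ^ (1 + q) ≤ Real.exp Y ^ (1 + q) := Real.rpow_le_rpow hY0.le h4 (by linarith)
      _ = Real.exp (Y * (1 + q)) := (Real.exp_mul _ _).symm
      _ ≤ Real.exp (3 * Y) := Real.exp_le_exp.2 (by nlinarith)
  have h5 : Real.exp (3 * Y) ≤
      Real.exp ((3 + C) * y₀) * Real.exp (8 * l * (Y - y₀) - C * Y) := by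
    rw [← Real.exp_add, Real.exp_le_exp]
    have : 0 ≤ (8 * l - (3 + C)) * (Y - y₀) :=
      mul_nonneg (by linarith) (sub_nonneg.2 hY)
    linarith
  have h6 : Y ^ (1 + q) < c * l ^ q * Real.exp (8 * l * (Y - y₀) - C * Y) :=
    (h3.trans h5).trans_lt (mul_lt_mul_of_pos_right h1 (Real.exp_pos _))
  have h7 : Y = Y ^ (1 + q) * Y ^ (-q) := by
    rw [← Real.rpow_add hY0, add_neg_cancel_right, Real.rpow_one]
  calc Y = Y ^ (1 + q) * Y ^ (-q) := h7
    _ < c * l ^ q * Real.exp (8 * l * (Y - y₀) - C * Y) * Y ^ (-q) :=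
        mul_lt_mul_of_pos_right h6 (Real.rpow_pos_of_pos hY0 _)
    _ = _ := by ring

/-! ### A lower bound for the Riesz form on a small ball -/

/-- The constant in the lower bound of the Riesz form by its restriction to a ball. -/
def shellConst (μ : ℝ) : ℝ := 2 ^ (-μ) * (15 / 256 * (Real.pi ^ 2 / 2) ^ 2)

lemma shellConst_pos (μ : ℝ) : 0 < shellConst μ := by
  have := Real.pi_pos
  unfold shellConst
  positivity

lemma volume_real_closedBall_R4 {r : ℝ} (hr : 0 ≤ r) :
    volume.real (Metric.closedBall (0 : R4) r) = r ^ 4 * (Real.pi ^ 2 / 2) := by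
  rw [Measure.real, Measure.addHaar_closedBall _ _ hr, finrank_euclideanSpace_fin,
    ENNReal.toReal_mul, ENNReal.toReal_ofReal (by positivity), ← volume_real_ball_R4, Measure.real]

/-- Restrict `x` to the outer shell and `y` to the ball of half radius: then `‖y‖ ≤ ‖x‖` and `0 < ‖x
- y‖ ≤ 2/N`. The kernel gives `N^μ`, the volumes `N⁻⁸`, and `15/256 = (1 - 1/16)/16`. -/
lemma shellConst_mul_le_rieszForm {μ : ℝ} (hμ0 : 0 < μ) (hμ : μ < 4) {N : ℝ} (hN : 0 < N)
    {m h : R4 → ℝ} (hm : Continuous m) (hms : HasCompactSupport m) (hh : Continuous h)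
    (hhs : HasCompactSupport h) (h0m : ∀ x, 0 ≤ m x) (h0h : ∀ x, 0 ≤ h x) {c : ℝ} (hc : 0 ≤ c)
    (hmh : ∀ x y, ‖x‖ ≤ N⁻¹ → ‖y‖ ≤ ‖x‖ → c ≤ m x * h y) :
    shellConst μ * N ^ (μ - 8) * c ≤ rieszForm μ m h := by
  have hNi : 0 < N⁻¹ := inv_pos.2 hN
  set A : Set R4 := Metric.closedBall 0 N⁻¹ \ Metric.closedBall 0 (N⁻¹ / 2)
  set B : Set R4 := Metric.closedBall 0 (N⁻¹ / 2)
  have hBf : volume B ≠ ⊤ := (isCompact_closedBall _ _).measure_lt_top.ne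
  have hBm : MeasurableSet B := Metric.isClosed_closedBall.measurableSet
  have hAm : MeasurableSet A := Metric.isClosed_closedBall.measurableSet.diff hBm
  have hAf : volume A ≠ ⊤ :=
    ((measure_mono sdiff_subset).trans_lt (isCompact_closedBall _ _).measure_lt_top).ne
  have hxy : ∀ x ∈ A, ∀ y ∈ B, ‖x‖ ≤ N⁻¹ ∧ N⁻¹ / 2 < ‖x‖ ∧ ‖y‖ ≤ N⁻¹ / 2 := by
    intro x hx y hy
    exact ⟨mem_closedBall_zero_iff.1 hx.1,
      not_le.1 fun h => hx.2 (mem_closedBall_zero_iff.2 h), mem_closedBall_zero_iff.1 hy⟩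
  have key := le_rieszForm hμ hm hms hh hhs h0m h0h hAm hBm hAf hBf (κ := (2 * N⁻¹) ^ (-μ)) hc
    (fun x hx y hy => by
      obtain ⟨h1, h2, h3⟩ := hxy x hx y hy
      refine Real.rpow_le_rpow_of_nonpos ?_ ?_ (by linarith)
      -- Strict positivity is needed: on the diagonal the kernel takes the default value `0 ^ (-μ) =
      -- 0`.
      · have := norm_sub_norm_le x y
        linarith
      · exact (norm_sub_le x y).trans (by linarith))
    (fun x hx y hy => by
      obtain ⟨h1, h2, h3⟩ := hxy x hx y hy
      exact hmh x y h1 (h3.trans h2.le))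
  have hvB : volume.real B = (N⁻¹ / 2) ^ 4 * (Real.pi ^ 2 / 2) :=
    volume_real_closedBall_R4 (by positivity)
  have hvA : volume.real A = N⁻¹ ^ 4 * (Real.pi ^ 2 / 2) - (N⁻¹ / 2) ^ 4 * (Real.pi ^ 2 / 2) := by
    rw [← hvB, ← volume_real_closedBall_R4 hNi.le]
    exact measureReal_sdiff (Metric.closedBall_subset_closedBall (by linarith)) hBm
      (isCompact_closedBall _ _).measure_lt_top.ne
  have e1 : (2 * N⁻¹) ^ (-μ) = 2 ^ (-μ) * N ^ μ := by
    rw [Real.mul_rpow two_pos.le hNi.le, Real.inv_rpow hN.le, Real.rpow_neg hN.le, inv_inv]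
  have e2 : N ^ (μ - 8) = N ^ μ * N⁻¹ ^ 8 := by
    rw [Real.rpow_sub hN, div_eq_mul_inv, inv_pow]
    norm_cast
  rw [hvA, hvB, e1] at key
  refine le_of_eq_of_le ?_ key
  rw [shellConst, e2]
  ring

/-! ### The maximum along the fibering map -/

/-- The energy along the fibering map, where `w` is the pair and `L` its Laplacian energy. -/
def fiberEnergy (μ : ℝ) (F : ℝ × ℝ → ℝ) (w : R4 → ℝ × ℝ) (L t : ℝ) : ℝ :=
  1 / 2 * (t ^ 2 * L) -
    1 / 2 * (t ^ (μ / 2 - 4) * rieszForm μ (fun x => F (t • w x)) (fun x => F (t • w x)))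

section

variable {F : ℝ × ℝ → ℝ} {w : R4 → ℝ × ℝ} {μ θ L : ℝ}

lemma rieszForm_frakF (hμ : μ < 4) (hF : ContDiff ℝ 1 F) (hF0 : F 0 = 0) (hw : Continuous w)
    (hws : HasCompactSupport w) (t : ℝ) :
    rieszForm μ (fun x => frakF μ F (t • w x)) (fun x => F (t • w x)) =
      rieszForm μ (fun x => zGradF F (t • w x)) (fun x => F (t • w x)) -
      (2 - μ / 4) * rieszForm μ (fun x => F (t • w x)) (fun x => F (t • w x)) := by
  have i1 := integrable_rieszForm hμ (continuous_comp_smul (continuous_zGradF hF) hw t)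
    (hasCompactSupport_comp_smul (zGradF_zero F) hws t)
    (continuous_comp_smul hF.continuous hw t) (hasCompactSupport_comp_smul hF0 hws t)
  have i2 := integrable_rieszForm hμ (continuous_comp_smul hF.continuous hw t)
    (hasCompactSupport_comp_smul hF0 hws t)
    (continuous_comp_smul hF.continuous hw t) (hasCompactSupport_comp_smul hF0 hws t)
  rw [rieszForm, rieszForm, rieszForm, ← integral_const_mul, ← integral_sub i1 (i2.const_mul _)]
  congr 1
  ext p
  rw [frakF]
  ring

/-- The bracket is the Pohozaev functional of the rescaled pair; differentiating `t^(μ/2-4)`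
produces the `-(2 - μ/4) F` part of `frakF`. -/
lemma hasDerivAt_fiberEnergy (hμ : μ < 4) (hF : ContDiff ℝ 1 F) (hF0 : F 0 = 0)
    (hw : Continuous w) (hws : HasCompactSupport w) {t : ℝ} (ht : 0 < t) :
    HasDerivAt (fiberEnergy μ F w L) (t⁻¹ * (t ^ 2 * L - t ^ (μ / 2 - 4) *
      rieszForm μ (fun x => frakF μ F (t • w x)) (fun x => F (t • w x)))) t := by
  have h1 := (((hasDerivAt_pow 2 t).mul_const L).const_mul (1 / 2)).sub
    (((Real.hasDerivAt_rpow_const (p := μ / 2 - 4) (Or.inl ht.ne')).mul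
      (hasDerivAt_rieszForm hμ hF hF0 hw hws ht)).const_mul (1 / 2))
  refine h1.congr_deriv ?_
  rw [rieszForm_frakF hμ hF hF0 hw hws, Real.rpow_sub_one ht.ne']
  field_simp
  push_cast
  ring

lemma SuperHomogeneous.exists_max_fiberEnergy (h : SuperHomogeneous θ F) (hθ : 3 - μ / 4 < θ)
    (hμ : μ < 4) (hF : ContDiff ℝ 1 F) (hw : Continuous w) (hws : HasCompactSupport w)
    (hL : 0 < L) (hpos : 0 < rieszForm μ (fun x => F (w x)) (fun x => F (w x))) :
    ∃ t, 0 < t ∧ IsMaxOn (fiberEnergy μ F w L) (Ioi 0) t ∧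
      t ^ 2 * L = t ^ (μ / 2 - 4) *
        rieszForm μ (fun x => frakF μ F (t • w x)) (fun x => F (t • w x)) := by
  have hθ0 : 0 < θ := by linarith
  have hF0 := h.zero hθ0 hF
  have hnn := h.nonneg hθ0 hF
  set Q := rieszForm μ (fun x => F (w x)) (fun x => F (w x))
  have hcw : Continuous fun x => F (w x) := hF.continuous.comp hw
  have hcws : HasCompactSupport fun x => F (w x) := hws.comp_left hF0
  have hpow : ∀ t : ℝ, 0 < t → 1 / 2 * Q * t ^ (2 * θ + (μ / 2 - 4)) =
      1 / 2 * (t ^ (μ / 2 - 4) * (t ^ θ * t ^ θ * Q)) := by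
    intro t ht
    rw [Real.rpow_add ht, two_mul, Real.rpow_add ht]
    ring
  have hcont : ContinuousOn (fiberEnergy μ F w L) (Ioi 0) := fun t ht =>
    (hasDerivAt_fiberEnergy hμ hF hF0 hw hws ht).continuousAt.continuousWithinAt
  obtain ⟨t, ht, hmax⟩ := exists_isMaxOn_of_superquadratic (L := 1 / 2 * L) (c := 1 / 2 * Q)
    (p := 2 * θ + (μ / 2 - 4)) hcont (by positivity) (by positivity) (by linarith)
    (fun t ht ht1 => by
      have hR : rieszForm μ (fun x => F (t • w x)) (fun x => F (t • w x)) ≤ t ^ θ * t ^ θ * Q := by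
        rw [← rieszForm_smul]
        exact rieszForm_mono hμ (continuous_comp_smul hF.continuous hw t)
          (hasCompactSupport_comp_smul hF0 hws t) (continuous_comp_smul hF.continuous hw t)
          (hasCompactSupport_comp_smul hF0 hws t) (continuous_const.mul hcw) hcws.mul_left
          (continuous_const.mul hcw) hcws.mul_left (fun _ => hnn _) (fun _ => hnn _)
          (fun _ => h.le_of_le_one hθ0 hF _ ht ht1) (fun _ => h.le_of_le_one hθ0 hF _ ht ht1)
      rw [hpow t ht, fiberEnergy]
      have := mul_le_mul_of_nonneg_left hR (Real.rpow_nonneg ht.le (μ / 2 - 4))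
      linarith)
    (fun t ht1 => by
      have ht : 0 < t := one_pos.trans_le ht1
      have hR : t ^ θ * t ^ θ * Q ≤ rieszForm μ (fun x => F (t • w x)) (fun x => F (t • w x)) := by
        rw [← rieszForm_smul]
        exact rieszForm_mono hμ (continuous_const.mul hcw) hcws.mul_left
          (continuous_const.mul hcw) hcws.mul_left (continuous_comp_smul hF.continuous hw t)
          (hasCompactSupport_comp_smul hF0 hws t) (continuous_comp_smul hF.continuous hw t)
          (hasCompactSupport_comp_smul hF0 hws t)
          (fun _ => mul_nonneg (by positivity) (hnn _))
          (fun _ => mul_nonneg (by positivity) (hnn _))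
          (fun _ => h.le_of_one_le hθ0 hF _ ht1) (fun _ => h.le_of_one_le hθ0 hF _ ht1)
      rw [hpow t ht, fiberEnergy]
      have := mul_le_mul_of_nonneg_left hR (Real.rpow_nonneg ht.le (μ / 2 - 4))
      linarith)
    (fun t ht => by
      have hR := rieszForm_nonneg (μ := μ) (fun x => hnn (t • w x)) (fun x => hnn (t • w x))
      have := mul_nonneg (Real.rpow_nonneg ht.le (μ / 2 - 4)) hR
      rw [fiberEnergy]
      linarith)
  refine ⟨t, ht, hmax, ?_⟩
  have h0 := (hmax.isLocalMax (Ioi_mem_nhds ht)).hasDerivAt_eq_zero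
    (hasDerivAt_fiberEnergy hμ hF hF0 hw hws ht)
  have := (mul_eq_zero.1 h0).resolve_left (inv_pos.2 ht).ne'
  linarith

end

/-! ### Estimates for multiples of the Adams functions -/

section

variable {F : ℝ × ℝ → ℝ} {Φ : ℝ → ℝ} {μ θ N A B t : ℝ}

lemma smul_pairMap (A B t : ℝ) (U : R4 → ℝ) (x : R4) :
    t • pairMap A B U x = (t * U x) • (A, B) := by
  simp only [pairMap, Prod.smul_mk, smul_eq_mul, Prod.mk.injEq]
  constructor <;> ring

lemma adamsRaw_anti (hN : 0 < N) {x y : R4} (hx : ‖x‖ ≤ N⁻¹) (hyx : ‖y‖ ≤ ‖x‖) :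
    adamsRaw Φ N x ≤ adamsRaw Φ N y := by
  rw [IsLogTruncation.adamsRaw_of_norm_le hx, IsLogTruncation.adamsRaw_of_norm_le (hyx.trans hx)]
  have : N ^ 2 * ‖y‖ ^ 2 ≤ N ^ 2 * ‖x‖ ^ 2 := by gcongr
  linarith

lemma rieszForm_adams_pos (hΦ : IsLogTruncation Φ) (h : SuperHomogeneous θ F) (hθ : 0 < θ)
    (hμ0 : 0 < μ) (hμ : μ < 4) (hF : ContDiff ℝ 1 F) (hN : 1 < N) (hA : 0 < A) :
    0 < rieszForm μ (fun x => F (pairMap A B (adamsRaw Φ N) x))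
      (fun x => F (pairMap A B (adamsRaw Φ N) x)) := by
  have hN0 : 0 < N := one_pos.trans hN
  have hl : 0 < Real.log N := Real.log_pos hN
  have hg := hΦ.hasLipschitzGradient_adamsRaw hN
  have hcw : Continuous fun x => F (pairMap A B (adamsRaw Φ N) x) :=
    hF.continuous.comp hg.continuous_pairMap
  have hcws : HasCompactSupport fun x => F (pairMap A B (adamsRaw Φ N) x) :=
    hg.hasCompactSupport_pairMap.comp_left (h.zero hθ hF)
  have hnn := h.nonneg hθ hF
  set c := F (Real.log N • (A, B))
  have hc : 0 < c := by
    refine h.pos hθ fun h0 => ?_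
    have : Real.log N * A = 0 := congrArg Prod.fst h0
    exact (mul_pos hl hA).ne' this
  have hcle : ∀ x : R4, ‖x‖ ≤ N⁻¹ → c ≤ F (pairMap A B (adamsRaw Φ N) x) := by
    intro x hx
    rw [← one_smul ℝ (pairMap A B (adamsRaw Φ N) x), smul_pairMap, one_mul]
    exact h.ray_mono hθ hF _ hl (IsLogTruncation.log_le_adamsRaw hN0 hx)
  refine lt_of_lt_of_le ?_ (shellConst_mul_le_rieszForm hμ0 hμ hN0 hcw hcws hcw hcws
    (fun _ => hnn _) (fun _ => hnn _) (c := c * c) (by positivity) fun x y hx hyx =>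
      mul_le_mul (hcle x hx) (hcle y (hyx.trans hx)) hc.le (hnn _))
  have := shellConst_pos μ
  positivity

/-- `(F₆)` bounds `F` and `z · ∇F` at one common point, whereas the Riesz form uses two. For `‖y‖ ≤
‖x‖` in the cap the profile is larger at `y`, and `F` increases along rays, so `F` at `y` may be
replaced by `F` at `x`. -/
lemma exp_le_rieszForm_adams (hΦ : IsLogTruncation Φ) (h : SuperHomogeneous θ F) (hθ : 0 < θ)
    (hμ0 : 0 < μ) (hμ : μ < 4) (hF : ContDiff ℝ 1 F) {c R : ℝ} (hc : 0 < c)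
    (hlow : ∀ z : ℝ × ℝ, R ≤ |z.1| → R ≤ |z.2| →
      c * Real.exp (64 * Real.pi ^ 2 * (z.1 ^ 2 + z.2 ^ 2)) ≤ F z * zGradF F z)
    (hN : 1 < N) (ht : 0 < t) (hA : 0 < A) (hB : 0 < B) (hRA : R ≤ t * A * Real.log N)
    (hRB : R ≤ t * B * Real.log N) :
    shellConst μ * N ^ (μ - 8) *
        (c * Real.exp (64 * Real.pi ^ 2 * (t ^ 2 * (A ^ 2 + B ^ 2) * Real.log N ^ 2))) ≤
      rieszForm μ (fun x => zGradF F (t • pairMap A B (adamsRaw Φ N) x))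
        (fun x => F (t • pairMap A B (adamsRaw Φ N) x)) := by
  have hN0 : 0 < N := one_pos.trans hN
  have hl : 0 < Real.log N := Real.log_pos hN
  have hg := hΦ.hasLipschitzGradient_adamsRaw hN
  have hw : Continuous (pairMap A B (adamsRaw Φ N)) := hg.continuous_pairMap
  have hws : HasCompactSupport (pairMap A B (adamsRaw Φ N)) := hg.hasCompactSupport_pairMap
  have hnn := h.nonneg hθ hF
  have hznn := h.zGradF_nonneg hθ hF
  refine shellConst_mul_le_rieszForm hμ0 hμ hN0 (continuous_comp_smul (continuous_zGradF hF) hw t)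
    (hasCompactSupport_comp_smul (zGradF_zero F) hws t) (continuous_comp_smul hF.continuous hw t)
    (hasCompactSupport_comp_smul (h.zero hθ hF) hws t) (fun _ => hznn _) (fun _ => hnn _)
    (by positivity) fun x y hx hyx => ?_
  have hUx : Real.log N ≤ adamsRaw Φ N x := IsLogTruncation.log_le_adamsRaw hN0 hx
  have hU0 : 0 < adamsRaw Φ N x := hl.trans_le hUx
  rw [smul_pairMap, smul_pairMap]
  have hmono : F ((t * adamsRaw Φ N x) • (A, B)) ≤ F ((t * adamsRaw Φ N y) • (A, B)) :=
    h.ray_mono hθ hF _ (by positivity) (mul_le_mul_of_nonneg_left (adamsRaw_anti hN0 hx hyx) ht.le)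
  have h1 : t * A * Real.log N ≤ t * adamsRaw Φ N x * A := by
    have := mul_le_mul_of_nonneg_left hUx (mul_pos ht hA).le
    linarith
  have h2 : t * B * Real.log N ≤ t * adamsRaw Φ N x * B := by
    have := mul_le_mul_of_nonneg_left hUx (mul_pos ht hB).le
    linarith
  have hz := hlow ((t * adamsRaw Φ N x) • (A, B)) ((hRA.trans h1).trans (le_abs_self _))
    ((hRB.trans h2).trans (le_abs_self _))
  simp only [Prod.smul_mk, smul_eq_mul] at hz
  have hexp : t ^ 2 * (A ^ 2 + B ^ 2) * Real.log N ^ 2 ≤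
      (t * adamsRaw Φ N x * A) ^ 2 + (t * adamsRaw Φ N x * B) ^ 2 := by
    have : Real.log N ^ 2 ≤ adamsRaw Φ N x ^ 2 := pow_le_pow_left₀ hl.le hUx 2
    calc t ^ 2 * (A ^ 2 + B ^ 2) * Real.log N ^ 2
        ≤ t ^ 2 * (A ^ 2 + B ^ 2) * adamsRaw Φ N x ^ 2 := by gcongr
      _ = _ := by ring
  calc c * Real.exp (64 * Real.pi ^ 2 * (t ^ 2 * (A ^ 2 + B ^ 2) * Real.log N ^ 2))
      ≤ c * Real.exp (64 * Real.pi ^ 2 *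
          ((t * adamsRaw Φ N x * A) ^ 2 + (t * adamsRaw Φ N x * B) ^ 2)) := by gcongr
    _ ≤ F ((t * adamsRaw Φ N x) • (A, B)) * zGradF F ((t * adamsRaw Φ N x) • (A, B)) := hz
    _ ≤ F ((t * adamsRaw Φ N y) • (A, B)) * zGradF F ((t * adamsRaw Φ N x) • (A, B)) :=
        mul_le_mul_of_nonneg_right hmono (hznn _)
    _ = _ := mul_comm _ _

end

/-! ### From `z · ∇F` to the Pohozaev density inside the Riesz form. -/

section

variable {F : ℝ × ℝ → ℝ} {w : R4 → ℝ × ℝ} {μ θ : ℝ}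

lemma SuperHomogeneous.mul_rieszForm_zGradF_le (h : SuperHomogeneous θ F) (hθ : 0 < θ)
    (hμ : μ < 4) (hF : ContDiff ℝ 1 F) (hw : Continuous w) (hws : HasCompactSupport w) (t : ℝ) :
    (1 - (2 - μ / 4) / θ) *
        rieszForm μ (fun x => zGradF F (t • w x)) (fun x => F (t • w x)) ≤
      rieszForm μ (fun x => frakF μ F (t • w x)) (fun x => F (t • w x)) := by
  have hF0 := h.zero hθ hF
  have hz := continuous_comp_smul (continuous_zGradF hF) hw t
  have hzs := hasCompactSupport_comp_smul (zGradF_zero F) hws t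
  have hf := continuous_comp_smul hF.continuous hw t
  have hfs := hasCompactSupport_comp_smul hF0 hws t
  have hk := continuous_comp_smul (continuous_frakF hF μ) hw t
  have hks := hasCompactSupport_comp_smul (G := frakF μ F) (by simp [frakF, zGradF_zero, hF0])
    hws t
  rw [rieszForm, rieszForm, ← integral_const_mul]
  refine integral_mono ((integrable_rieszForm hμ hz hzs hf hfs).const_mul _)
    (integrable_rieszForm hμ hk hks hf hfs) fun p => ?_
  have h1 := h.mul_zGradF_le_frakF hθ hF (μ := μ) (by linarith) (t • w p.1)
  have h2 : 0 ≤ ‖p.1 - p.2‖ ^ (-μ) * F (t • w p.2) :=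
    mul_nonneg (by positivity) (h.nonneg hθ hF _)
  have h3 := mul_le_mul_of_nonneg_left h1 h2
  simp only
  linarith

end

/-! ### Elementary inequalities between `t`, `Y` and `l = log N`. -/

section

variable {C₀ C₁ L Y l m r t : ℝ}

/-- If `Y ≥ y₀`, both coordinates on the cap grow at least like `√l`, hence pass the threshold `R`
beyond which `(F₆)` applies. -/
lemma sq_coordinate_lower_bound {A a y₀ : ℝ} (hC₁ : 0 < C₁) (hr : 0 < r) (hy₀ : 0 < y₀)
    (hl : 1 ≤ l) (hL : L = 8 * Real.pi ^ 2 * l + C₁) (hY : y₀ ≤ Y)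
    (ht : t ^ 2 = Y * m / (r * L)) (hA : A ^ 2 * m = a ^ 2) :
    y₀ / (r * (8 * Real.pi ^ 2 + C₁)) * a ^ 2 * l ≤ (t * A * l) ^ 2 := by
  have hπ := Real.pi_pos
  have hl0 : 0 < l := one_pos.trans_le hl
  have hL0 : 0 < L := by rw [hL]; positivity
  have h1 : (t * A * l) ^ 2 = Y * a ^ 2 * l ^ 2 / (r * L) := by
    rw [mul_pow, mul_pow, ht, ← hA]
    ring
  have h2 : L ≤ (8 * Real.pi ^ 2 + C₁) * l := by
    rw [hL, add_mul]
    have := mul_le_mul_of_nonneg_left hl hC₁.le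
    linarith
  rw [h1, le_div_iff₀ (by positivity)]
  calc y₀ / (r * (8 * Real.pi ^ 2 + C₁)) * a ^ 2 * l * (r * L)
      ≤ y₀ / (r * (8 * Real.pi ^ 2 + C₁)) * a ^ 2 * l * (r * ((8 * Real.pi ^ 2 + C₁) * l)) := by
        gcongr
    _ = y₀ * a ^ 2 * l ^ 2 := by field_simp
    _ ≤ Y * a ^ 2 * l ^ 2 := by gcongr

/-- A difference of squares: `(8l - C₁/π²)(8π² l + C₁) = 64π² l² - C₁²/π²`. -/
lemma critical_exponent_lower_bound (hC₁ : 0 < C₁) (hl : 0 < l) (hY : 0 < Y)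
    (hL : L = 8 * Real.pi ^ 2 * l + C₁) :
    8 * l * Y - C₁ / Real.pi ^ 2 * Y ≤ 64 * Real.pi ^ 2 * (Y / L * l ^ 2) := by
  have hπ := Real.pi_pos
  have hL0 : 0 < L := by rw [hL]; positivity
  have h1 : (8 * l - C₁ / Real.pi ^ 2) * L ≤ 64 * Real.pi ^ 2 * l ^ 2 := by
    have h2 : 0 ≤ C₁ ^ 2 / Real.pi ^ 2 := by positivity
    have h3 : (8 * l - C₁ / Real.pi ^ 2) * L =
        64 * Real.pi ^ 2 * l ^ 2 - C₁ ^ 2 / Real.pi ^ 2 := by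
      rw [hL]
      field_simp
      ring
    linarith
  calc 8 * l * Y - C₁ / Real.pi ^ 2 * Y = (8 * l - C₁ / Real.pi ^ 2) * L * (Y / L) := by
        field_simp
    _ ≤ 64 * Real.pi ^ 2 * l ^ 2 * (Y / L) :=
        mul_le_mul_of_nonneg_right h1 (div_pos hY hL0).le
    _ = _ := by ring

/-- Source of the decisive factor `l^(2-μ/4)`: bounded mass and `L ≥ 8π² l` force `t² ≲ Y / l`, and
the exponent of `t` is negative. -/
lemma scale_rpow_lower_bound {μ : ℝ} (hC₁ : 0 < C₁) (hr : 0 < r) (hl : 0 < l) (hY : 0 < Y)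
    (hC₀ : 0 < C₀) (ht : 0 < t) (hmC : m ≤ C₀) (hμ : 0 ≤ 2 - μ / 4)
    (hL : L = 8 * Real.pi ^ 2 * l + C₁) (htY : t ^ 2 = Y * m / (r * L)) :
    (C₀ / (r * (8 * Real.pi ^ 2))) ^ (-(2 - μ / 4)) * l ^ (2 - μ / 4) * Y ^ (-(2 - μ / 4)) ≤
      t ^ (μ / 2 - 4) := by
  have hπ := Real.pi_pos
  have h1 : t ^ (μ / 2 - 4) = (t ^ 2) ^ (-(2 - μ / 4)) := by
    rw [← Real.rpow_natCast t 2, ← Real.rpow_mul ht.le]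
    congr 1
    push_cast
    ring
  have h2 : t ^ 2 ≤ C₀ / (r * (8 * Real.pi ^ 2)) * Y * l⁻¹ := by
    have h3 : 8 * Real.pi ^ 2 * l ≤ L := by rw [hL]; linarith
    calc t ^ 2 = Y * m / (r * L) := htY
      _ ≤ Y * C₀ / (r * (8 * Real.pi ^ 2 * l)) := by gcongr
      _ = _ := by field_simp
  have hC₃ : 0 < C₀ / (r * (8 * Real.pi ^ 2)) := by positivity
  have h4 : (C₀ / (r * (8 * Real.pi ^ 2)) * Y * l⁻¹) ^ (-(2 - μ / 4)) =
      (C₀ / (r * (8 * Real.pi ^ 2))) ^ (-(2 - μ / 4)) * l ^ (2 - μ / 4) *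
        Y ^ (-(2 - μ / 4)) := by
    rw [Real.mul_rpow (by positivity) (by positivity), Real.mul_rpow hC₃.le hY.le,
      Real.inv_rpow hl.le, Real.rpow_neg hl.le, inv_inv]
    ring
  rw [h1, ← h4]
  exact Real.rpow_le_rpow_of_nonpos (by positivity) h2 (by linarith)

end

/-- A critical point of the fibering energy has subcritical Laplacian energy, once the
concentration parameter is large. -/
lemma eventually_subcritical {F : ℝ × ℝ → ℝ} {Φ : ℝ → ℝ} {μ θ a b : ℝ} (hμ0 : 0 < μ) (hμ : μ < 4)
    (ha : 0 < a) (hb : 0 < b) (hΦ : IsLogTruncation Φ) (h : SuperHomogeneous θ F)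
    (hθ : 3 - μ / 4 < θ) (hF : ContDiff ℝ 1 F) (hF6 : CondF6 F) :
    ∀ᶠ N : ℝ in atTop, ∀ t A B : ℝ, 0 < t → 0 < A → 0 < B →
      A ^ 2 * adamsRawMass Φ N = a ^ 2 → B ^ 2 * adamsRawMass Φ N = b ^ 2 →
      t ^ 2 * ((A ^ 2 + B ^ 2) * ∫ x, lineDivergence (radialGrad (adamsSlope Φ N)) x ^ 2) =
        t ^ (μ / 2 - 4) * rieszForm μ (fun x => frakF μ F (t • pairMap A B (adamsRaw Φ N) x))
          (fun x => F (t • pairMap A B (adamsRaw Φ N) x)) →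
      t ^ 2 * ((A ^ 2 + B ^ 2) * ∫ x, lineDivergence (radialGrad (adamsSlope Φ N)) x ^ 2) <
        (8 - μ) / 8 := by
  have hθ0 : 0 < θ := by linarith
  have hπ := Real.pi_pos
  obtain ⟨c, R, hc, hlow⟩ := hF6.exists_lower_bound
  obtain ⟨C₀, hC₀, hmass⟩ := hΦ.exists_adamsRawMass_le
  -- The value for which `N ^ (μ - 8) = exp (-(8 * l * y₀))`.
  set y₀ : ℝ := (8 - μ) / 8 with hy₀
  have hy₀0 : 0 < y₀ := by rw [hy₀]; linarith
  set q : ℝ := 2 - μ / 4 with hq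
  have hq0 : 0 < q := by rw [hq]; linarith
  set C₁ : ℝ := 2 * Real.pi ^ 2 * (4 + tailEnergy Φ) with hC₁
  have hC₁0 : 0 < C₁ := by
    have := tailEnergy_nonneg Φ
    positivity
  set C₂ : ℝ := C₁ / Real.pi ^ 2 with hC₂
  set r : ℝ := a ^ 2 + b ^ 2 with hr
  have hr0 : 0 < r := by positivity
  set C₃ : ℝ := C₀ / (r * (8 * Real.pi ^ 2)) with hC₃
  have hC₃0 : 0 < C₃ := by positivity
  set k : ℝ := 1 - q / θ with hk
  have hk0 : 0 < k := by
    rw [hk, sub_pos, div_lt_one hθ0]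
    linarith
  set c' : ℝ := C₃ ^ (-q) * k * (shellConst μ * c) with hc'
  have hc'0 : 0 < c' := by
    have := shellConst_pos μ
    positivity
  set d : ℝ := y₀ / (r * (8 * Real.pi ^ 2 + C₁)) with hd
  have hd0 : 0 < d := by positivity
  have hlarge := eventually_lt_rpow_mul_exp (C := C₂) hq0 (by rw [hq]; linarith) hc'0 hy₀0
  have hall := ((hlarge.and (eventually_ge_atTop 1)).and
    ((tendsto_id.const_mul_atTop (mul_pos hd0 (pow_pos ha 2))).eventually_ge_atTop (R ^ 2))).and
    ((tendsto_id.const_mul_atTop (mul_pos hd0 (pow_pos hb 2))).eventually_ge_atTop (R ^ 2))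
  filter_upwards [Real.tendsto_log_atTop.eventually hall, eventually_gt_atTop 1] with N hN hN1
  obtain ⟨⟨⟨hexp, hl1⟩, hRa⟩, hRb⟩ := hN
  intro t A B ht hA hB hAm hBm hP
  have hN0 : 0 < N := one_pos.trans hN1
  set l := Real.log N with hl
  have hl0 : 0 < l := one_pos.trans_le hl1
  set m := adamsRawMass Φ N
  have hm0 : 0 < m := hΦ.adamsRawMass_pos hN1
  have hmC : m ≤ C₀ := hmass N hN1
  set L := ∫ x, lineDivergence (radialGrad (adamsSlope Φ N)) x ^ 2 with hL
  have hLeq : L = 8 * Real.pi ^ 2 * l + C₁ := by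
    rw [hL, hΦ.integral_lineDivergence_sq hN1, hC₁]
    ring
  have hL0 : 0 < L := by rw [hLeq]; positivity
  by_contra! hcon
  set Y := t ^ 2 * ((A ^ 2 + B ^ 2) * L) with hY
  have hY0 : 0 < Y := hy₀0.trans_le hcon
  have hABm : (A ^ 2 + B ^ 2) * m = r := by rw [add_mul, hAm, hBm]
  -- Eliminates `A` and `B` through the mass constraints, so only `Y`, `m` and `L` remain.
  have htY : t ^ 2 = Y * m / (r * L) := by
    rw [hY, ← hABm]
    field_simp
  have hS : t ^ 2 * (A ^ 2 + B ^ 2) = Y / L := by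
    rw [hY]
    field_simp
  have hcoord : ∀ {A a : ℝ}, 0 < A → A ^ 2 * m = a ^ 2 → R ^ 2 ≤ d * a ^ 2 * l →
      R ≤ t * A * l := by
    intro A a hA hAm hRa
    refine le_of_abs_le (abs_le_of_sq_le_sq (hRa.trans ?_) (by positivity))
    exact sq_coordinate_lower_bound hC₁0 hr0 hy₀0 hl1 hLeq hcon htY hAm
  have hZ := exp_le_rieszForm_adams hΦ h hθ0 hμ0 hμ hF hc hlow hN1 ht hA hB
    (hcoord hA hAm hRa) (hcoord hB hBm hRb)
  have hg := hΦ.hasLipschitzGradient_adamsRaw hN1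
  have hfr := h.mul_rieszForm_zGradF_le hθ0 hμ hF (hg.continuous_pairMap (A := A) (B := B))
    hg.hasCompactSupport_pairMap t
  have hE : 8 * l * Y - C₂ * Y ≤ 64 * Real.pi ^ 2 * (t ^ 2 * (A ^ 2 + B ^ 2) * l ^ 2) := by
    rw [hS]
    exact critical_exponent_lower_bound hC₁0 hl0 hY0 hLeq
  have hT : C₃ ^ (-q) * l ^ q * Y ^ (-q) ≤ t ^ (μ / 2 - 4) :=
    scale_rpow_lower_bound hC₁0 hr0 hl0 hY0 hC₀ ht hmC (by linarith) hLeq htY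
  have hNp : N ^ (μ - 8) = Real.exp (-(8 * l * y₀)) := by
    rw [Real.rpow_def_of_pos hN0, ← hl, hy₀]
    congr 1
    ring
  have hsc := shellConst_pos μ
  have hlt := hexp Y hcon
  refine hlt.not_ge ?_
  calc c' * l ^ q * Y ^ (-q) * Real.exp (8 * l * (Y - y₀) - C₂ * Y)
      = (C₃ ^ (-q) * l ^ q * Y ^ (-q)) * (k * (shellConst μ * N ^ (μ - 8) *
          (c * Real.exp (8 * l * Y - C₂ * Y)))) := by
        rw [hNp, hc', show 8 * l * (Y - y₀) - C₂ * Y = -(8 * l * y₀) + (8 * l * Y - C₂ * Y) by ring,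
          Real.exp_add]
        ring
    _ ≤ t ^ (μ / 2 - 4) * (k * (shellConst μ * N ^ (μ - 8) *
          (c * Real.exp (64 * Real.pi ^ 2 * (t ^ 2 * (A ^ 2 + B ^ 2) * l ^ 2))))) := by
        gcongr
    _ ≤ t ^ (μ / 2 - 4) * (k * rieszForm μ
          (fun x => zGradF F (t • pairMap A B (adamsRaw Φ N) x))
          (fun x => F (t • pairMap A B (adamsRaw Φ N) x))) := by gcongr
    _ ≤ t ^ (μ / 2 - 4) * rieszForm μ
          (fun x => frakF μ F (t • pairMap A B (adamsRaw Φ N) x))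
          (fun x => F (t • pairMap A B (adamsRaw Φ N) x)) := by gcongr
    _ = Y := hP.symm

end BiharmonicChoquard

end

/-! ### Assembly of the result. -/

theorem lemma5p10 (μ : ℝ) (hμ0 : 0 < μ) (hμ4 : μ < 4)
    (a b : ℝ) (ha : 0 < a) (hb : 0 < b)
    (F : ℝ × ℝ → ℝ)
    (hF1 : BiharmonicChoquard.CondF1 μ F)
    (hF2 : BiharmonicChoquard.CondF2 μ F)
    (hF6 : BiharmonicChoquard.CondF6 F)
    (hcrit1 : BiharmonicChoquard.CriticalGrowth (BiharmonicChoquard.dF1 F))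
    (hcrit2 : BiharmonicChoquard.CriticalGrowth (BiharmonicChoquard.dF2 F))
    (φ : ℝ → ℝ) (hφ : BiharmonicChoquard.IsCutoff φ) :
    ∃ N : ℕ, ∀ n : ℕ, N ≤ n →
      ∃ t : ℝ, 0 < t ∧
        IsMaxOn (BiharmonicChoquard.fiberG μ F a b φ n) (Set.Ioi 0) t ∧
        BiharmonicChoquard.fiberG μ F a b φ n t < (8 - μ) / 16 ∧
        BiharmonicChoquard.groundEnergy μ F a b ≤
          ((BiharmonicChoquard.fiberG μ F a b φ n t : ℝ) : EReal) := by
  open BiharmonicChoquard in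
  obtain ⟨hF, -⟩ := hF1
  obtain ⟨θ, hθ, hsup⟩ := hF2
  have h : SuperHomogeneous θ F := hsup
  have hθ0 : 0 < θ := by linarith
  have hF0 := h.zero hθ0 hF
  have hΦ := hφ.isLogTruncation
  set Φ : ℝ → ℝ := fun s => φ (√s) * (Real.log s / 2) with hΦdef
  have hev := tendsto_natCast_atTop_atTop.eventually
    (eventually_subcritical hμ0 hμ4 ha hb hΦ h hθ hF hF6)
  obtain ⟨N, hN⟩ := (hev.and (eventually_ge_atTop 2)).exists_forall_of_atTop
  refine ⟨N, fun n hn => ?_⟩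
  obtain ⟨hsub, hn2⟩ := hN n hn
  have hn1 : (1 : ℝ) < n := by exact_mod_cast hn2
  have hg := hΦ.hasLipschitzGradient_adamsRaw hn1
  have hm0 := hΦ.adamsRawMass_pos hn1
  have hsm := Real.sqrt_pos.2 hm0
  have hmass : ∀ c : ℝ, (c / √(adamsRawMass Φ n)) ^ 2 * adamsRawMass Φ n = c ^ 2 := by
    intro c
    rw [div_pow, Real.sq_sqrt hm0.le, div_mul_cancel₀ _ hm0.ne']
  set A := a / √(adamsRawMass Φ n) with hA
  set B := b / √(adamsRawMass Φ n) with hB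
  have hA0 : 0 < A := div_pos ha hsm
  have hB0 : 0 < B := div_pos hb hsm
  set L₀ := ∫ x, lineDivergence (radialGrad (adamsSlope Φ n)) x ^ 2 with hL₀
  have hL₀0 : 0 < L₀ := by
    rw [hL₀, hΦ.integral_lineDivergence_sq hn1]
    have h1 := Real.log_pos hn1
    have h2 := tailEnergy_nonneg Φ
    have h3 := Real.pi_pos
    positivity
  have hw : Continuous (pairMap A B (adamsRaw Φ n)) := hg.continuous_pairMap
  have hws : HasCompactSupport (pairMap A B (adamsRaw Φ n)) := hg.hasCompactSupport_pairMap
  obtain ⟨t, ht, hmax, hP⟩ := h.exists_max_fiberEnergy (L := (A ^ 2 + B ^ 2) * L₀) hθ hμ4 hF hw hws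
    (by positivity) (rieszForm_adams_pos hΦ h hθ0 hμ0 hμ4 hF hn1 hA0)
  have hu : ∀ (c t : ℝ), (fun x => t * adamsMass φ c n (√t • x)) =
      fun x => t * (c / √(adamsRawMass Φ n)) * adamsRaw Φ n (√t • x) := by
    intro c t
    ext x
    rw [adamsMass_eq φ hφ hn2, ← hΦdef, mul_assoc]
  have hG : ∀ t, 0 < t → fiberG μ F a b φ n t =
      fiberEnergy μ F (pairMap A B (adamsRaw Φ n)) ((A ^ 2 + B ^ 2) * L₀) t := by
    intro t ht
    rw [fiberG, hu, hu, ← hA, ← hB, hg.energyJ_fiber hμ4 ht hF.continuous hF0, fiberEnergy]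
  refine ⟨t, ht, fun s hs => ?_, ?_, ?_⟩
  · rw [mem_ofPred_eq, hG s hs, hG t ht]
    exact hmax hs
  -- Dropping the nonnegative Riesz term leaves half the Laplacian energy, below `(8 - μ) / 16`.
  · have hlt := hsub t A B ht hA0 hB0 (hmass a) (hmass b) hP
    have hR := rieszForm_nonneg (μ := μ)
      (fun x => h.nonneg hθ0 hF (t • pairMap A B (adamsRaw Φ n) x))
      (fun x => h.nonneg hθ0 hF (t • pairMap A B (adamsRaw Φ n) x))
    have hR' := mul_nonneg (Real.rpow_nonneg ht.le (μ / 2 - 4)) hR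
    rw [hG t ht, fiberEnergy]
    linarith
  · rw [groundEnergy, fiberG]
    -- The maximizing pair is itself a competitor: the critical point equation `hP` is the Pohozaev
    -- constraint.
    refine iInf₂_le (α := EReal) ((fun x => t * adamsMass φ a n (√t • x)),
      (fun x => t * adamsMass φ b n (√t • x))) ⟨?_, ?_⟩
    · rw [hu, hu]
      exact hg.mem_massS ht (hmass a) (hmass b)
    · simp only
      rw [hu, hu, hg.pohozaevP_fiber hμ4 ht hF hF0, ← hA, ← hB, hP, sub_self]
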